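/- For every integer $m\ge 2$ there is a constant $C=C(m)$, depending only on $m$, such that for every integer $k$ with $2\le k\le m$ and every finite-dimensional real Banach space $X$, $$w_m(X)\le C\,\lambda(X^*)^{m-k}\,w_k(X).$$ Here, with $B_X$ the closed unit ball of $X$ and for $m\ge 2$, $$w_m(X)=\sup\Big\{\inf_{\varphi\in\mathcal P_{m-1}}\sup_{x\in B_X}|f(x)-\varphi(x)| \;:\; f\in C(B_X;\mathbb R),\ \omega_m(f)\le 1\Big\}$$ is the Whitney constant, where $\mathcal P_{m-1}$ is the space of real polynomials on $X$ of total degree at most $m-1$ and $$\omega_m(f)=\sup\Big\{\Big|\sum_{j=0}^m(-1)^{m-j}\tbinom mj f(x+jh)\Big| \;:\; x,h\in X,\ x,x+h,\dots,x+mh\in B_X\Big\};$$ and for a finite-dimensional Banach space $Y$, $\lambda(Y)$ is the projection constant, i.e. the smallest $\lambda\ge 1$ such that whenever $Y$ is embedded isometrically in a Banach space $Z$ there is a linear projection $P:Z\to Y$ with $\|P\|\le\lambda$. Further, $X^*$ is the dual of $X$ with the dual norm. -/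

import Mathlib

open scoped NNReal ENNReal

noncomputable section

namespace Whitney

universe u

/-- The real polynomials of total degree at most `d` on a real vector space `E`, in coordinate-free
form: sums of homogeneous polynomials `x ↦ A j (x, …, x)` of degree `j = 0, …, d`, where `A j` is a
`j`-linear form. For `E = ℝⁿ` these are exactly the polynomials in `n` variables of total degree at
most `d`. -/
def polynomials (E : Type u) [AddCommGroup E] [Module ℝ E] (d : ℕ) : Set (E → ℝ) :=
  {φ | ∃ A : (j : ℕ) → MultilinearMap ℝ (fun _ : Fin j => E) ℝ,
    ∀ x : E, φ x = ∑ j ∈ Finset.range (d + 1), A j (fun _ => x)}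

/-- `E_m(f; K) = inf {sup_{x ∈ K} |f(x) - φ(x)| : φ a polynomial of degree at most m - 1}`,
with values in `[0, ∞]`. -/
def bestApprox {E : Type u} [AddCommGroup E] [Module ℝ E] (m : ℕ) (K : Set E) (f : E → ℝ) :
    ℝ≥0∞ :=
  ⨅ φ ∈ polynomials E (m - 1), ⨆ x ∈ K, ENNReal.ofReal |f x - φ x|

/-- `ω_m(f; K)`: the supremum of `|Δ_h^m f(x)|` over all `x`, `h` such that `x, x + h, …, x + m h`
all lie in `K`, where `Δ_h^m f(x) = ∑_{j ≤ m} (-1)^(m - j) (m choose j) f(x + j h)`.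
Only values of `f` on `K` enter. -/
def modulus {E : Type u} [AddCommGroup E] [Module ℝ E] (m : ℕ) (K : Set E) (f : E → ℝ) :
    ℝ≥0∞ :=
  ⨆ (x : E) (h : E) (_ : ∀ j : ℕ, j ≤ m → x + (j : ℝ) • h ∈ K),
    ENNReal.ofReal
      |∑ j ∈ Finset.range (m + 1), (-1 : ℝ) ^ (m - j) * (m.choose j : ℝ) * f (x + (j : ℝ) • h)|

/-- The Whitney constant `w_m(K) = sup {E_m(f; K) : f continuous on K, ω_m(f; K) ≤ 1}`,
with values in `[0, ∞]`. -/
def whitneyConst {E : Type u} [NormedAddCommGroup E] [NormedSpace ℝ E] (m : ℕ) (K : Set E) :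
    ℝ≥0∞ :=
  ⨆ (f : E → ℝ) (_ : ContinuousOn f K) (_ : modulus m K f ≤ 1), bestApprox m K f

/-- The Whitney constant `w_m(X)` of a normed space: that of its closed unit ball. -/
def whitneyConstSpace (X : Type u) [NormedAddCommGroup X] [NormedSpace ℝ X] (m : ℕ) : ℝ≥0∞ :=
  whitneyConst m (Metric.closedBall (0 : X) 1)

/-- `c` is admissible for `Y` if, whenever `Y` is embedded by a linear isometry `ι` in a Banach
space `Z`, there is a linear projection of `Z` onto `Y` of norm at most `c` (a linear map
`P : Z → Y` with `P ∘ ι = id`). It is enough to let `Z` run over the universe of `Y`: that universe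
contains `ℓ_∞(Γ)` with `Γ` the dual unit ball of `Y`; `Y` embeds isometrically in it, and by
injectivity of `ℓ_∞(Γ)` a projection from it onto `Y` yields, for every `Z`, one of no larger
norm. -/
def IsProjectionBound (Y : Type u) [NormedAddCommGroup Y] [NormedSpace ℝ Y] (c : ℝ≥0) : Prop :=
  ∀ (Z : Type u) [NormedAddCommGroup Z] [NormedSpace ℝ Z] [CompleteSpace Z] (ι : Y →ₗᵢ[ℝ] Z),
    ∃ P : Z →L[ℝ] Y, (∀ y : Y, P (ι y) = y) ∧ ‖P‖ ≤ c

/-- The projection constant `λ(Y)`: the smallest admissible `c ≥ 1`. As an infimum in `[0, ∞]` it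
would be `∞` if no `c` were admissible. -/
def projectionConst (Y : Type u) [NormedAddCommGroup Y] [NormedSpace ℝ Y] : ℝ≥0∞ :=
  ⨅ (c : ℝ≥0) (_ : 1 ≤ c) (_ : IsProjectionBound Y c), (c : ℝ≥0∞)

end Whitney

end

/-!
The inequality is proved one order at a time: for `n ≥ 2`, `w_{n+1}(X) ≤ K λ(X*) w_n(X)` with `K`
depending only on `n` (`exists_whitneyConstSpace_succ_le`), and the theorem follows by induction.

Let `f` be continuous on the unit ball with `ω_{n+1}(f) ≤ 1`. By Kemperman's identity
(`mixedDiff_eq_sum_fwdDiff_iter`), all mixed differences of `f` of order `n + 1` are bounded near the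
origin, so `Δ_h^n f` is almost constant there. Two consequences carry the argument.

* The function `G x = Δ_x^n f 0` behaves like a form of degree `n`: up to `O(1)`, the differences
  `Δ_h^n G` are `n!` times those of `f`. Hence `f - G / n!` has bounded `n`-th differences near the
  origin (`diffBound_sub_diag`) and is within `O(w_n)` of a polynomial of degree `n - 1`.
* `G` is within `O(λ w_n)` of a homogeneous polynomial of degree `n` (`exists_top_approx`). Write
  `G h = q_h h` with `q_h z = Δ_h^{n-1} f z - Δ_h^{n-1} f 0`. For fixed `h`, the function `q_h` is
  almost additive, hence within `O(w_n)` of a linear functional (`exists_linear_approx`); for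
  fixed `z`, the increment `x ↦ f (x + z) - f x` is within `O(w_n)` of a polynomial of degree
  `n - 1`, so `q_h z` is within `O(w_n)` of an `(n - 1)`-homogeneous polynomial `B_z h`. Embed `X*` in
  the bounded functions on the unit ball by restriction, and let `P` be a projection back onto it.
  As `P` reproduces functionals, `q_h` is close to `P q_h`, which in turn is close to
  `P (z ↦ B_z h)`, each time with a single loss of the factor `‖P‖`; and `P (z ↦ B_z h) h` is a
  polynomial of degree `n` in `h` (`projection_mem_polynomials`). The argument avoids approximating
  in one variable after another, which would cost a second factor `w_n`.

Adding up, `f` is close to a polynomial of degree `n` on a ball whose radius depends only on `n`. The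
bound propagates to the unit ball along the lines through the origin (`abs_le_of_abs_le_small`), and
the additive constants are absorbed by a lower bound for `w_n(X)`
(`exists_pos_le_whitneyConstSpace`).
-/

open scoped NNReal ENNReal

namespace Whitney

universe u

open Finset Metric

/-! ### Differences and their mixed versions -/

section

variable {E : Type*} [AddCommGroup E] [Module ℝ E]

theorem fwdDiff_iter_eq_sum (m : ℕ) (h : E) (f : E → ℝ) (x : E) :
    (fwdDiff h)^[m] f x =
      ∑ j ∈ range (m + 1), (-1 : ℝ) ^ (m - j) * (m.choose j : ℝ) * f (x + (j : ℝ) • h) := by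
  rw [fwdDiff_iter_eq_sum_shift]
  refine Finset.sum_congr rfl fun j _ => ?_
  rw [Nat.cast_smul_eq_nsmul, zsmul_eq_mul]
  push_cast
  ring

theorem sum_choose_abs (m : ℕ) :
    ∑ j ∈ range (m + 1), |(-1 : ℝ) ^ (m - j) * (m.choose j : ℝ)| = 2 ^ m := by
  have : ∀ j ∈ range (m + 1), |(-1 : ℝ) ^ (m - j) * (m.choose j : ℝ)| = (m.choose j : ℝ) := by
    intro j _
    rw [abs_mul, abs_pow, abs_neg, abs_one, one_pow, one_mul, Nat.abs_cast]
  rw [Finset.sum_congr rfl this]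
  exact_mod_cast Nat.sum_range_choose m

theorem abs_fwdDiff_iter_le {m : ℕ} {h : E} {f : E → ℝ} {x : E} {D : ℝ}
    (hD : ∀ j ≤ m, |f (x + (j : ℝ) • h)| ≤ D) : |(fwdDiff h)^[m] f x| ≤ 2 ^ m * D := by
  rw [fwdDiff_iter_eq_sum, ← sum_choose_abs, Finset.sum_mul]
  refine (Finset.abs_sum_le_sum_abs _ _).trans (Finset.sum_le_sum fun j hj => ?_)
  rw [abs_mul]
  exact mul_le_mul_of_nonneg_left (hD j (by simpa [Nat.lt_succ_iff] using hj)) (abs_nonneg _)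

theorem sum_choose_pow_eq_zero {i n : ℕ} (h : i < n) :
    ∑ j ∈ range (n + 1), (-1 : ℝ) ^ (n - j) * (n.choose j : ℝ) * (j : ℝ) ^ i = 0 := by
  have := congrFun (fwdDiff_iter_pow_eq_zero_of_lt (R := ℝ) h) 0
  rw [fwdDiff_iter_eq_sum] at this
  simpa using this

theorem sum_choose_pow_eq_factorial (n : ℕ) :
    ∑ j ∈ range (n + 1), (-1 : ℝ) ^ (n - j) * (n.choose j : ℝ) * (j : ℝ) ^ n = n.factorial := by
  have := congrFun (fwdDiff_iter_eq_factorial (R := ℝ) (n := n)) 0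
  rw [fwdDiff_iter_eq_sum] at this
  simpa using this

theorem multilinear_diag_smul {n : ℕ} (A : MultilinearMap ℝ (fun _ : Fin n => E) ℝ) (t : ℝ)
    (x : E) : A (fun _ => t • x) = t ^ n * A (fun _ => x) := by
  simpa using A.map_smul_univ (fun _ => t) (fun _ => x)

/-- The difference at the origin of a sum of homogeneous polynomials of degree at most `n` sees only
the part of degree `n`. -/
theorem fwdDiff_iter_polynomial_zero (n : ℕ)
    (A : (j : ℕ) → MultilinearMap ℝ (fun _ : Fin j => E) ℝ) (φ : E → ℝ)
    (hφ : ∀ x : E, φ x = ∑ j ∈ range (n + 1), A j (fun _ => x)) (h : E) :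
    (fwdDiff h)^[n] φ 0 = n.factorial * A n (fun _ => h) := by
  rw [fwdDiff_iter_eq_sum]
  simp only [hφ, zero_add, multilinear_diag_smul, Finset.mul_sum]
  rw [Finset.sum_comm, Finset.sum_range_succ, ← sum_choose_pow_eq_factorial, Finset.sum_mul,
    Finset.sum_eq_zero, zero_add]
  · exact Finset.sum_congr rfl fun j _ => by ring
  · intro i hi
    rw [← zero_mul (A i fun _ => h), ← sum_choose_pow_eq_zero (mem_range.1 hi), Finset.sum_mul]
    exact Finset.sum_congr rfl fun j _ => by ring

theorem fwdDiff_iter_polynomial_eq_zero {n m : ℕ} (hnm : n < m) {φ : E → ℝ}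
    (hφ : φ ∈ polynomials E n) (h : E) : (fwdDiff h)^[m] φ 0 = 0 := by
  obtain ⟨A, hA⟩ := hφ
  rw [fwdDiff_iter_eq_sum]
  simp only [hA, zero_add, multilinear_diag_smul, Finset.mul_sum]
  rw [Finset.sum_comm]
  refine Finset.sum_eq_zero fun i hi => ?_
  rw [← zero_mul (A i fun _ => h),
    ← sum_choose_pow_eq_zero ((Nat.lt_succ_iff.1 (mem_range.1 hi)).trans_lt hnm), Finset.sum_mul]
  exact Finset.sum_congr rfl fun j _ => by ring

/-- The mixed difference `Δ_{v 0} ⋯ Δ_{v (k - 1)} f x`, expanded as a signed sum over the subsets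
of `{0, …, k - 1}`. -/
def mixedDiff (v : ℕ → E) (k : ℕ) (f : E → ℝ) (x : E) : ℝ :=
  ∑ S ∈ (range k).powerset, (-1 : ℝ) ^ (k + #S) * f (x + ∑ i ∈ S, v i)

theorem mixedDiff_succ {E : Type*} [AddCommGroup E] (v : ℕ → E) (k : ℕ) (f : E → ℝ) :
    mixedDiff v (k + 1) f = fwdDiff (v k) (mixedDiff v k f) := by
  funext x
  simp only [mixedDiff, fwdDiff]
  rw [Finset.range_add_one, Finset.sum_powerset_insert (by simp), add_comm, sub_eq_add_neg,
    ← Finset.sum_neg_distrib]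
  congr 1 <;> refine Finset.sum_congr rfl fun S hS => ?_
  · have : k ∉ S := fun hk => by simpa using Finset.mem_powerset.1 hS hk
    rw [Finset.card_insert_of_notMem this, Finset.sum_insert this, ← add_assoc x,
      show k + 1 + (#S + 1) = k + #S + 2 by ring, pow_add]
    simp
  · rw [show k + 1 + #S = k + #S + 1 by ring, pow_succ]
    ring

theorem mixedDiff_eq_zero {E : Type*} [AddCommGroup E] {v : ℕ → E} {k i : ℕ} (hi : i < k)
    (hv : v i = 0) (f : E → ℝ) :
    mixedDiff v k f = 0 := by
  induction k with
  | zero => omega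
  | succ k ih =>
    rw [mixedDiff_succ]
    rcases Nat.lt_succ_iff_lt_or_eq.1 hi with h | rfl
    · rw [ih h]; funext x; simp [fwdDiff]
    · rw [hv]; funext x; simp [fwdDiff]

theorem mixedDiff_two {E : Type*} [AddCommGroup E] (a b : E) (p q : ℕ) (f : E → ℝ) :
    mixedDiff (fun i => if i < p then a else b) (p + q) f =
      (fwdDiff b)^[q] ((fwdDiff a)^[p] f) := by
  induction q with
  | zero =>
    have : ∀ k ≤ p, mixedDiff (fun i => if i < p then a else b) k f = (fwdDiff a)^[k] f := by
      intro k hk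
      induction k with
      | zero => funext x; simp [mixedDiff]
      | succ k ih =>
        rw [mixedDiff_succ, ih (by omega), Function.iterate_succ_apply', if_pos (by omega)]
    simpa using this p le_rfl
  | succ q ih =>
    rw [← add_assoc, mixedDiff_succ, ih, Function.iterate_succ_apply', if_neg (by omega)]

/-- Kemperman's identity: a mixed difference is a signed sum of pure differences of the same order.
Expanding the pure differences and summing over `S` first, the terms of index `j ≥ 1` are mixed
differences with a vanishing step, and the terms of index `0` give the left-hand side. -/
theorem mixedDiff_eq_sum_fwdDiff_iter (v : ℕ → E) (m : ℕ) (f : E → ℝ) (x : E) :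
    mixedDiff v m f x = ∑ S ∈ (range m).powerset, (-1 : ℝ) ^ #S *
      (fwdDiff (-∑ i ∈ S, ((i : ℝ) + 1)⁻¹ • v i))^[m] f (x + ∑ i ∈ S, v i) := by
  simp only [fwdDiff_iter_eq_sum, Finset.mul_sum]
  rw [Finset.sum_comm, Finset.sum_range_succ', Finset.sum_eq_zero, zero_add]
  · simp only [mixedDiff]
    exact Finset.sum_congr rfl fun S _ => by simp [pow_add]; ring
  · intro j hj
    have h0 := congrFun (mixedDiff_eq_zero
      (v := fun i => (1 - ((j : ℝ) + 1) * ((i : ℝ) + 1)⁻¹) • v i) (mem_range.1 hj)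
      (by rw [mul_inv_cancel₀ (by positivity)]; simp) f) x
    simp only [mixedDiff, Pi.zero_apply] at h0
    rw [← mul_zero ((-1 : ℝ) ^ m * (-1 : ℝ) ^ (m - (j + 1)) * (m.choose (j + 1) : ℝ)), ← h0,
      Finset.mul_sum]
    refine Finset.sum_congr rfl fun S _ => ?_
    have e : x + ∑ i ∈ S, v i + ((j + 1 : ℕ) : ℝ) • -∑ i ∈ S, ((i : ℝ) + 1)⁻¹ • v i =
        x + ∑ i ∈ S, (1 - ((j : ℝ) + 1) * ((i : ℝ) + 1)⁻¹) • v i := by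
      rw [add_assoc, smul_neg, Finset.smul_sum, ← sub_eq_add_neg, ← Finset.sum_sub_distrib]
      congr 1
      refine Finset.sum_congr rfl fun i _ => ?_
      rw [sub_smul, one_smul, smul_smul]
      push_cast
      rfl
    rw [e, pow_add]
    have : (-1 : ℝ) ^ m * (-1) ^ m = 1 := by rw [← mul_pow]; simp
    linear_combination (-(-1 : ℝ) ^ #S * (-1) ^ (m - (j + 1)) * (m.choose (j + 1) : ℝ) *
      f (x + ∑ i ∈ S, (1 - ((j : ℝ) + 1) * ((i : ℝ) + 1)⁻¹) • v i)) * this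

end

section

variable {X : Type*} [NormedAddCommGroup X] [NormedSpace ℝ X]

theorem abs_mixedDiff_le {m : ℕ} {f : X → ℝ}
    (hf : ∀ x h : X, (∀ j : ℕ, j ≤ m → x + (j : ℝ) • h ∈ closedBall (0 : X) 1) →
      |(fwdDiff h)^[m] f x| ≤ 1)
    {v : ℕ → X} {x : X} (hv : ‖x‖ + (m + 1) * ∑ i ∈ range m, ‖v i‖ ≤ 1) :
    |mixedDiff v m f x| ≤ 2 ^ m := by
  rw [mixedDiff_eq_sum_fwdDiff_iter]
  refine (Finset.abs_sum_le_sum_abs _ _).trans ?_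
  refine (Finset.sum_le_card_nsmul _ _ 1 fun S hS => ?_).trans (by simp)
  rw [abs_mul, abs_pow, abs_neg, abs_one, one_pow, one_mul]
  have hsub := Finset.mem_powerset.1 hS
  refine hf _ _ fun j hj => ?_
  rw [mem_closedBall_zero_iff]
  have h1 : ‖∑ i ∈ S, v i‖ ≤ ∑ i ∈ range m, ‖v i‖ :=
    (norm_sum_le _ _).trans (Finset.sum_le_sum_of_subset_of_nonneg hsub fun _ _ _ => norm_nonneg _)
  have h2 : ‖∑ i ∈ S, ((i : ℝ) + 1)⁻¹ • v i‖ ≤ ∑ i ∈ range m, ‖v i‖ := by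
    refine (norm_sum_le _ _).trans ((Finset.sum_le_sum fun i _ => ?_).trans
      (Finset.sum_le_sum_of_subset_of_nonneg hsub fun _ _ _ => norm_nonneg _))
    rw [norm_smul, Real.norm_of_nonneg (by positivity)]
    exact mul_le_of_le_one_left (norm_nonneg _) (inv_le_one_of_one_le₀ (by simp))
  have hj' : (j : ℝ) ≤ m := by exact_mod_cast hj
  calc ‖x + ∑ i ∈ S, v i + (j : ℝ) • -∑ i ∈ S, ((i : ℝ) + 1)⁻¹ • v i‖
      ≤ ‖x‖ + ‖∑ i ∈ S, v i‖ + ‖(j : ℝ) • -∑ i ∈ S, ((i : ℝ) + 1)⁻¹ • v i‖ := norm_add₃_le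
    _ ≤ ‖x‖ + (∑ i ∈ range m, ‖v i‖) + m * ∑ i ∈ range m, ‖v i‖ := by
        rw [norm_smul, norm_neg, Real.norm_natCast]
        gcongr
    _ ≤ 1 := by linarith

theorem abs_fwdDiff_fwdDiff_le {p q : ℕ} {f : X → ℝ}
    (hf : ∀ x h : X, (∀ j : ℕ, j ≤ p + q → x + (j : ℝ) • h ∈ closedBall (0 : X) 1) →
      |(fwdDiff h)^[p + q] f x| ≤ 1)
    {a b x : X} (hx : ‖x‖ + (p + q + 1) * (p * ‖a‖ + q * ‖b‖) ≤ 1) :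
    |(fwdDiff b)^[q] ((fwdDiff a)^[p] f) x| ≤ 2 ^ (p + q) := by
  rw [← mixedDiff_two]
  refine abs_mixedDiff_le hf ?_
  rw [Finset.sum_range_add]
  have h1 : ∑ i ∈ range p, ‖(if i < p then a else b)‖ = p * ‖a‖ := by
    rw [Finset.sum_congr rfl fun i hi => by rw [if_pos (mem_range.1 hi)]]; simp
  have h2 : ∑ i ∈ range q, ‖(if p + i < p then a else b)‖ = q * ‖b‖ := by
    rw [Finset.sum_congr rfl fun i _ => by rw [if_neg (by omega)]]; simp
  rw [h1, h2]
  push_cast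
  exact hx

end

/-! ### Polynomials, Whitney constants and linear approximation -/

section Polynomials

variable {E : Type*} [AddCommGroup E] [Module ℝ E]

theorem polynomials_diag {n : ℕ} (A : MultilinearMap ℝ (fun _ : Fin n => E) ℝ) :
    (fun x => A fun _ => x) ∈ polynomials E n := by
  refine ⟨fun j => if h : j = n then h ▸ A else 0, fun x => ?_⟩
  rw [Finset.sum_eq_single_of_mem n (by simp) fun j _ hj => by simp [hj]]
  simp

theorem polynomials_add {d : ℕ} {p q : E → ℝ} (hp : p ∈ polynomials E d)
    (hq : q ∈ polynomials E d) : (fun x => p x + q x) ∈ polynomials E d := by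
  obtain ⟨A, hA⟩ := hp
  obtain ⟨B, hB⟩ := hq
  exact ⟨fun j => A j + B j, fun x => by simp [hA, hB, Finset.sum_add_distrib]⟩

theorem polynomials_mono {d e : ℕ} (hde : d ≤ e) {p : E → ℝ} (hp : p ∈ polynomials E d) :
    p ∈ polynomials E e := by
  obtain ⟨A, hA⟩ := hp
  refine ⟨fun j => if j ≤ d then A j else 0, fun x => ?_⟩
  rw [hA, ← Finset.sum_subset (Finset.range_subset_range.2 (Nat.succ_le_succ hde))]
  · refine Finset.sum_congr rfl fun j hj => ?_
    simp only [if_pos (Nat.lt_succ_iff.1 (mem_range.1 hj))]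
  · intro j _ hj
    simp only [if_neg (show ¬j ≤ d by simpa using hj)]
    rfl

theorem polynomials_smul_comp_smul {d : ℕ} {p : E → ℝ} (hp : p ∈ polynomials E d) (a b : ℝ) :
    (fun x => a * p (b • x)) ∈ polynomials E d := by
  obtain ⟨A, hA⟩ := hp
  refine ⟨fun j => (a * b ^ j) • A j, fun x => ?_⟩
  simp [hA, multilinear_diag_smul, Finset.mul_sum, mul_assoc]

end Polynomials

section

variable {X : Type u} [NormedAddCommGroup X] [NormedSpace ℝ X]

/-- `|Δ_h^m f x| ≤ M` as long as the points `x, x + h, …, x + m h` lie in the ball of radius `ρ`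
around the origin; that is, `ω_m(f) ≤ M` on this ball. -/
def DiffBound (m : ℕ) (ρ M : ℝ) (f : X → ℝ) : Prop :=
  ∀ x h : X, (∀ j : ℕ, j ≤ m → x + (j : ℝ) • h ∈ closedBall (0 : X) ρ) →
    |(fwdDiff h)^[m] f x| ≤ M

theorem modulus_le_iff {m : ℕ} {M : ℝ} (hM : 0 ≤ M) {ρ : ℝ} {f : X → ℝ} :
    modulus m (closedBall 0 ρ) f ≤ ENNReal.ofReal M ↔ DiffBound m ρ M f := by
  simp only [modulus, iSup_le_iff, DiffBound, fwdDiff_iter_eq_sum, ENNReal.ofReal_le_ofReal_iff hM]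

theorem bestApprox_le_whitneyConstSpace {m : ℕ} {f : X → ℝ} (hf : ContinuousOn f (closedBall 0 1))
    (hm : modulus m (closedBall (0 : X) 1) f ≤ 1) :
    bestApprox m (closedBall (0 : X) 1) f ≤ whitneyConstSpace X m := by
  unfold whitneyConstSpace whitneyConst
  exact le_iSup_of_le f (le_iSup_of_le hf (le_iSup_of_le hm le_rfl))

/-- The Whitney constant of the unit ball controls approximation on a ball of any radius. -/
theorem exists_polynomial_approx {m : ℕ} {W : ℝ} (hW : whitneyConstSpace X m < ENNReal.ofReal W)
    {ρ M : ℝ} (hρ : 0 < ρ) (hM : 0 < M) {g : X → ℝ} (hg : ContinuousOn g (closedBall 0 ρ))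
    (hd : DiffBound m ρ M g) :
    ∃ p ∈ polynomials X (m - 1), ∀ x ∈ closedBall (0 : X) ρ, |g x - p x| ≤ W * M := by
  have hmem : ∀ x : X, x ∈ closedBall (0 : X) 1 → ρ • x ∈ closedBall (0 : X) ρ := by
    intro x hx
    rw [mem_closedBall_zero_iff] at hx ⊢
    rw [norm_smul, Real.norm_of_nonneg hρ.le]
    exact mul_le_of_le_one_right hρ.le hx
  have hcont : ContinuousOn (fun x => M⁻¹ * g (ρ • x)) (closedBall 0 1) :=
    continuousOn_const.mul (hg.comp (by fun_prop) hmem)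
  have hmod : modulus m (closedBall (0 : X) 1) (fun x => M⁻¹ * g (ρ • x)) ≤ 1 := by
    rw [← ENNReal.ofReal_one, modulus_le_iff zero_le_one]
    intro x h hxh
    have e : (fwdDiff h)^[m] (fun x => M⁻¹ * g (ρ • x)) x =
        M⁻¹ * (fwdDiff (ρ • h))^[m] g (ρ • x) := by
      simp only [fwdDiff_iter_eq_sum, Finset.mul_sum]
      refine Finset.sum_congr rfl fun j _ => ?_
      rw [smul_add, smul_comm ρ]
      ring
    rw [e, abs_mul, abs_of_pos (inv_pos.2 hM), inv_mul_le_iff₀ hM, mul_one]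
    refine hd _ _ fun j hj => ?_
    rw [smul_comm, ← smul_add]
    exact hmem _ (hxh j hj)
  have hlt : bestApprox m (closedBall (0 : X) 1) (fun x => M⁻¹ * g (ρ • x)) <
      ENNReal.ofReal W :=
    lt_of_le_of_lt (bestApprox_le_whitneyConstSpace hcont hmod) hW
  have hWpos : 0 < W := ENNReal.ofReal_pos.1 (bot_lt_of_lt hW)
  simp only [bestApprox, iInf_lt_iff] at hlt
  obtain ⟨p, hp, hlt⟩ := hlt
  refine ⟨fun x => M * p (ρ⁻¹ • x), polynomials_smul_comp_smul hp _ _, fun x hx => ?_⟩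
  have hx1 : ρ⁻¹ • x ∈ closedBall (0 : X) 1 := by
    rw [mem_closedBall_zero_iff] at hx ⊢
    rwa [norm_smul, Real.norm_of_nonneg (inv_nonneg.2 hρ.le), inv_mul_le_iff₀ hρ, mul_one]
  have h1 := (le_iSup₂ (f := fun x (_ : x ∈ closedBall (0 : X) 1) =>
    ENNReal.ofReal |M⁻¹ * g (ρ • x) - p x|) _ hx1).trans hlt.le
  rw [ENNReal.ofReal_le_ofReal_iff hWpos.le, smul_inv_smul₀ hρ.ne'] at h1
  have e : g x - M * p (ρ⁻¹ • x) = M * (M⁻¹ * g x - p (ρ⁻¹ • x)) := by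
    rw [mul_sub, mul_inv_cancel_left₀ hM.ne']
  rw [e, abs_mul, abs_of_pos hM, mul_comm W]
  exact mul_le_mul_of_nonneg_left h1 hM.le

theorem whitneyConstSpace_le {m : ℕ} {D : ℝ}
    (h : ∀ f : X → ℝ, ContinuousOn f (closedBall 0 1) → DiffBound m 1 1 f →
      ∃ p ∈ polynomials X (m - 1), ∀ x ∈ closedBall (0 : X) 1, |f x - p x| ≤ D) :
    whitneyConstSpace X m ≤ ENNReal.ofReal D := by
  refine iSup_le fun f => iSup_le fun hf => iSup_le fun hm => ?_
  rw [← ENNReal.ofReal_one, modulus_le_iff zero_le_one] at hm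
  obtain ⟨p, hp, hpD⟩ := h f hf hm
  exact iInf₂_le_of_le p hp (iSup₂_le fun x hx => ENNReal.ofReal_le_ofReal (hpD x hx))

theorem whitneyConstSpace_of_subsingleton [Subsingleton X] (m : ℕ) :
    whitneyConstSpace X m = 0 := by
  rw [← nonpos_iff_eq_zero, ← ENNReal.ofReal_zero]
  refine whitneyConstSpace_le fun f _ _ => ⟨fun _ => f 0, ?_, fun x _ => ?_⟩
  · exact polynomials_mono (Nat.zero_le _)
      (polynomials_diag (MultilinearMap.constOfIsEmpty ℝ (fun _ : Fin 0 => X) (f 0)))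
  · rw [Subsingleton.elim x 0]; simp

end

/-- The Whitney constants of the nontrivial spaces are bounded below: the powers `ℓ ^ m` of a
norming functional `ℓ` have an `m`-th difference that does not vanish, whereas those of the
polynomials of degree less than `m` do. -/
theorem exists_pos_le_whitneyConstSpace (m : ℕ) (hm : 1 ≤ m) :
    ∃ κ : ℝ, 0 < κ ∧ ∀ (X : Type u) [NormedAddCommGroup X] [NormedSpace ℝ X] [Nontrivial X],
      ENNReal.ofReal κ ≤ whitneyConstSpace X m := by
  have hm0 : (0 : ℝ) < m := by exact_mod_cast hm
  refine ⟨(2 ^ m)⁻¹ * ((2 ^ m)⁻¹ * ((m : ℝ)⁻¹ ^ m * m.factorial)), by positivity, ?_⟩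
  intro X _ _ _
  obtain ⟨e, he⟩ := exists_norm_eq X zero_le_one
  obtain ⟨l, hl, hle⟩ := exists_dual_vector ℝ e (by rw [← norm_ne_zero_iff, he]; simp)
  rw [he] at hle
  have hcont : ContinuousOn (fun x => (2 ^ m : ℝ)⁻¹ * l x ^ m) (closedBall 0 1) := by fun_prop
  have hmod : modulus m (closedBall (0 : X) 1) (fun x => (2 ^ m : ℝ)⁻¹ * l x ^ m) ≤ 1 := by
    rw [← ENNReal.ofReal_one, modulus_le_iff zero_le_one]
    intro x h hxh
    refine (abs_fwdDiff_iter_le (D := (2 ^ m : ℝ)⁻¹) fun j hj => ?_).trans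
      (mul_inv_cancel₀ (by positivity)).le
    have hj1 := mem_closedBall_zero_iff.1 (hxh j hj)
    rw [abs_mul, abs_of_pos (by positivity), abs_pow]
    refine mul_le_of_le_one_right (by positivity) (pow_le_one₀ (abs_nonneg _) ?_)
    calc |l (x + (j : ℝ) • h)| ≤ ‖l‖ * ‖x + (j : ℝ) • h‖ := l.le_opNorm _
      _ ≤ 1 := by rw [hl, one_mul]; exact hj1
  refine le_trans ?_ (bestApprox_le_whitneyConstSpace hcont hmod)
  refine le_iInf₂ fun p hp => ?_
  by_contra! hlt
  obtain ⟨b, hb⟩ : ∃ b, b = ⨆ x ∈ closedBall (0 : X) 1,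
      ENNReal.ofReal |(2 ^ m : ℝ)⁻¹ * l x ^ m - p x| := ⟨_, rfl⟩
  have hbound : ∀ x ∈ closedBall (0 : X) 1,
      ENNReal.ofReal |(2 ^ m : ℝ)⁻¹ * l x ^ m - p x| ≤ b := by
    intro x hx
    rw [hb]
    exact le_iSup₂ (f := fun x (_ : x ∈ closedBall (0 : X) 1) =>
      ENNReal.ofReal |(2 ^ m : ℝ)⁻¹ * l x ^ m - p x|) x hx
  rw [← hb] at hlt
  have hB : ∀ x ∈ closedBall (0 : X) 1, |(2 ^ m : ℝ)⁻¹ * l x ^ m - p x| ≤ b.toReal := by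
    intro x hx
    exact (ENNReal.ofReal_le_iff_le_toReal hlt.ne_top).1 (hbound x hx)
  have h1 : |(fwdDiff ((m : ℝ)⁻¹ • e))^[m]
      ((fun x => (2 ^ m : ℝ)⁻¹ * l x ^ m) + (-1 : ℝ) • p) 0| ≤ 2 ^ m * b.toReal := by
    refine abs_fwdDiff_iter_le fun j hj => ?_
    have := hB (0 + (j : ℝ) • (m : ℝ)⁻¹ • e) ?_
    · simpa [sub_eq_add_neg] using this
    · rw [mem_closedBall_zero_iff, zero_add, norm_smul, norm_smul, he, norm_inv,
        Real.norm_natCast, Real.norm_natCast, mul_one, mul_inv_le_iff₀ hm0, one_mul]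
      exact_mod_cast hj
  have h2 : (fwdDiff ((m : ℝ)⁻¹ • e))^[m] (fun x => (2 ^ m : ℝ)⁻¹ * l x ^ m) 0 =
      (2 ^ m)⁻¹ * ((m : ℝ)⁻¹ ^ m * m.factorial) := by
    rw [fwdDiff_iter_eq_sum, ← sum_choose_pow_eq_factorial, Finset.mul_sum, Finset.mul_sum]
    refine Finset.sum_congr rfl fun j _ => ?_
    simp only [zero_add, map_smul, smul_eq_mul, hle]
    simp only [RCLike.ofReal_real_eq_id, id_eq, mul_one, mul_pow]
    ring
  rw [fwdDiff_iter_add, fwdDiff_iter_const_smul, Pi.add_apply, Pi.smul_apply,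
    fwdDiff_iter_polynomial_eq_zero (by omega) hp, smul_zero, add_zero, h2,
    abs_of_pos (by positivity)] at h1
  have h3 : b.toReal < (2 ^ m)⁻¹ * ((2 ^ m)⁻¹ * ((m : ℝ)⁻¹ ^ m * m.factorial)) := by
    rw [← ENNReal.lt_ofReal_iff_toReal_lt hlt.ne_top]
    exact hlt
  rw [lt_inv_mul_iff₀ (by positivity)] at h3
  linarith

/-- A function that is nearly homogeneous of degree one, in the sense that `q z ≈ 2 q (z / 2)`,
stays close to the linear part of any polynomial close to it: passing from a polynomial `p` to
`(2 p (z / 2) - t p z) / (1 - t)` with `t = 2 ^ (1 - j)` removes its part of degree `j`, and fixes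
the linear part. -/
theorem exists_bound_linear_part (s : Finset ℕ) (hs : 1 ∉ s) :
    ∃ K : ℝ, 0 < K ∧ ∀ (X : Type u) [NormedAddCommGroup X] [NormedSpace ℝ X] (ρ M D : ℝ)
      (q : X → ℝ) (l : X →ₗ[ℝ] ℝ) (A : (j : ℕ) → MultilinearMap ℝ (fun _ : Fin j => X) ℝ),
      (∀ z ∈ closedBall (0 : X) ρ, |q z - 2 * q ((2 : ℝ)⁻¹ • z)| ≤ M) →
      (∀ z ∈ closedBall (0 : X) ρ, |q z - l z - ∑ j ∈ s, A j (fun _ => z)| ≤ D) →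
      ∀ z ∈ closedBall (0 : X) ρ, |q z - l z| ≤ K * (M + D) := by
  induction s using Finset.induction_on with
  | empty =>
    refine ⟨1, one_pos, fun X _ _ ρ M D q l A hq hD z hz => ?_⟩
    have h1 := hD z hz
    have h2 := (abs_nonneg _).trans (hq z hz)
    simp only [Finset.sum_empty, sub_zero] at h1
    linarith
  | insert j s hj ih =>
    obtain ⟨K, hK, ih⟩ := ih fun h => hs (Finset.mem_insert_of_mem h)
    have hj1 : j ≠ 1 := fun h => hs (by simp [h])
    set t : ℕ → ℝ := fun i => 2 * (2 : ℝ)⁻¹ ^ i with ht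
    have ht1 : 1 - t j ≠ 0 := by
      intro h0
      have h2 : (2 : ℝ)⁻¹ ^ j = (2 : ℝ)⁻¹ ^ 1 := by simp only [ht] at h0; linarith
      exact hj1 (pow_right_injective₀ (by norm_num) (by norm_num) h2)
    have htpos : 0 < |1 - t j| := abs_pos.2 ht1
    have htj : 0 ≤ t j ∧ t j ≤ 2 :=
      ⟨by positivity, by
        have : (2 : ℝ)⁻¹ ^ j ≤ 1 := pow_le_one₀ (by norm_num) (by norm_num)
        simp only [ht]; linarith⟩
    refine ⟨K * (1 + |1 - t j|⁻¹ * 4), by positivity, fun X _ _ ρ M D q l A hq hD z hz => ?_⟩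
    have hM : 0 ≤ M := (abs_nonneg _).trans (hq z hz)
    have hD0 : 0 ≤ D := (abs_nonneg _).trans (hD z hz)
    refine (ih X ρ M (|1 - t j|⁻¹ * (4 * D + M)) q l
      (fun i => ((1 - t j)⁻¹ * (t i - t j)) • A i) hq ?_ z hz).trans ?_
    · intro z hz
      have hz2 : (2 : ℝ)⁻¹ • z ∈ closedBall (0 : X) ρ := by
        rw [mem_closedBall_zero_iff] at hz ⊢
        rw [norm_smul, Real.norm_of_nonneg (by norm_num)]
        linarith [norm_nonneg z]
      have h1 := hD z hz
      have h2 := hD _ hz2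
      have h3 := hq z hz
      rw [Finset.sum_insert hj] at h1 h2
      simp only [multilinear_diag_smul, map_smul, smul_eq_mul] at h2
      have e : q z - l z - ∑ i ∈ s, (((1 - t j)⁻¹ * (t i - t j)) • A i) (fun _ => z) =
          (1 - t j)⁻¹ * (2 * (q ((2 : ℝ)⁻¹ • z) - 2⁻¹ * l z -
            (2⁻¹ ^ j * A j (fun _ => z) + ∑ i ∈ s, 2⁻¹ ^ i * A i (fun _ => z))) -
            t j * (q z - l z - (A j (fun _ => z) + ∑ i ∈ s, A i (fun _ => z))) +
            (q z - 2 * q ((2 : ℝ)⁻¹ • z))) := by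
        rw [eq_inv_mul_iff_mul_eq₀ ht1, mul_sub, Finset.mul_sum]
        have : ∑ i ∈ s, (1 - t j) * (((1 - t j)⁻¹ * (t i - t j)) • A i) (fun _ => z) =
            2 * ∑ i ∈ s, 2⁻¹ ^ i * A i (fun _ => z) - t j * ∑ i ∈ s, A i (fun _ => z) := by
          rw [Finset.mul_sum, Finset.mul_sum, ← Finset.sum_sub_distrib]
          refine Finset.sum_congr rfl fun i _ => ?_
          rw [smul_apply, smul_eq_mul, ← mul_assoc, mul_inv_cancel_left₀ ht1]
          simp only [ht]
          ring
        rw [this]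
        simp only [ht]
        ring
      rw [e, abs_mul, abs_inv]
      refine mul_le_mul_of_nonneg_left ?_ (by positivity)
      refine (abs_add_le _ _).trans (add_le_add ((abs_sub _ _).trans ?_) h3)
      rw [abs_mul, abs_mul, abs_two, abs_of_nonneg htj.1]
      nlinarith [abs_nonneg (q z - l z - (A j (fun _ => z) + ∑ i ∈ s, A i (fun _ => z)))]
    · rw [mul_assoc]
      refine mul_le_mul_of_nonneg_left ?_ hK.le
      have : 0 ≤ |1 - t j|⁻¹ := by positivity
      nlinarith

/-- A function with bounded second differences that vanishes at the origin is approximated by a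
linear functional, with an error controlled by the Whitney constant of any order `d + 1 ≥ 2`. -/
theorem exists_linear_approx (d : ℕ) (hd : 1 ≤ d) :
    ∃ K : ℝ, 0 < K ∧ ∀ (X : Type u) [NormedAddCommGroup X] [NormedSpace ℝ X]
      [FiniteDimensional ℝ X] (W : ℝ), whitneyConstSpace X (d + 1) < ENNReal.ofReal W →
      ∀ (ρ M : ℝ) (q : X → ℝ), 0 < ρ → 0 < M → ContinuousOn q (closedBall 0 ρ) → q 0 = 0 →
      DiffBound 2 ρ M q →
      ∃ l : StrongDual ℝ X, ∀ z ∈ closedBall (0 : X) ρ, |q z - l z| ≤ K * (1 + W) * M := by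
  obtain ⟨K, hK, hlin⟩ := exists_bound_linear_part.{u} ((range (d + 1)).erase 1) (by simp)
  refine ⟨K * 2 ^ d, by positivity, fun X _ _ _ W hW ρ M q hρ hM hq hq0 hq2 => ?_⟩
  have hWpos : 0 < W := ENNReal.ofReal_pos.1 (bot_lt_of_lt hW)
  have hdiff : DiffBound (d + 1) ρ (2 ^ d * M) q := by
    intro x h hxh
    obtain ⟨e, rfl⟩ : ∃ e, d = e + 1 := ⟨d - 1, by omega⟩
    rw [show e + 1 + 1 = e + 2 from rfl, Function.iterate_add_apply]
    refine (abs_fwdDiff_iter_le (D := M) fun j hj => ?_).trans ?_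
    · refine hq2 _ _ fun i hi => ?_
      have := hxh (j + i) (by omega)
      rw [add_assoc, ← add_smul]
      exact_mod_cast this
    · exact mul_le_mul_of_nonneg_right (pow_le_pow_right₀ (by norm_num) (by omega)) hM.le
  obtain ⟨p, ⟨A, hA⟩, hp⟩ := exists_polynomial_approx hW hρ (by positivity) hq hdiff
  simp only [Nat.add_sub_cancel] at hA
  have h1 : ∀ z ∈ closedBall (0 : X) ρ, |q z - 2 * q ((2 : ℝ)⁻¹ • z)| ≤ M := by
    intro z hz
    have hz' := mem_closedBall_zero_iff.1 hz
    have := hq2 0 ((2 : ℝ)⁻¹ • z) fun j hj => by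
      rw [zero_add, smul_smul, mem_closedBall_zero_iff, norm_smul,
        Real.norm_of_nonneg (by positivity)]
      have : (j : ℝ) * 2⁻¹ ≤ 1 := by
        have : (j : ℝ) ≤ 2 := by exact_mod_cast hj
        linarith
      exact (mul_le_of_le_one_left (norm_nonneg _) this).trans hz'
    rw [fwdDiff_iter_eq_sum] at this
    simp only [Finset.sum_range_succ, Finset.sum_range_zero] at this
    norm_num [hq0, smul_smul] at this
    rw [show q z - 2 * q ((2 : ℝ)⁻¹ • z) = -(2 * q ((1 / 2 : ℝ) • z)) + q z by
      rw [one_div]; ring]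
    exact this
  refine ⟨LinearMap.toContinuousLinearMap ((A 1).toLinearMap (fun _ => 0) 0), fun z hz => ?_⟩
  have h2 := hlin X ρ M (W * (2 ^ d * M)) q ((A 1).toLinearMap (fun _ => 0) 0) A h1 ?_ z hz
  · simp only [LinearMap.coe_toContinuousLinearMap']
    refine h2.trans ?_
    have : (1 : ℝ) ≤ 2 ^ d := one_le_pow₀ (by norm_num)
    rw [mul_assoc, mul_assoc]
    refine mul_le_mul_of_nonneg_left ?_ hK.le
    nlinarith
  · intro z hz
    have e : ∑ j ∈ range (d + 1), A j (fun _ => z) =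
        (A 1).toLinearMap (fun _ => 0) 0 z + ∑ j ∈ (range (d + 1)).erase 1, A j (fun _ => z) := by
      rw [← Finset.add_sum_erase _ _ (show 1 ∈ range (d + 1) by rw [mem_range]; omega)]
      congr 1
      rw [MultilinearMap.toLinearMap_apply]
      congr 1
      funext i
      rw [Subsingleton.elim i 0, Function.update_self]
    have := hp z hz
    rw [hA, e] at this
    rwa [sub_sub]

/-! ### Polarization and projections onto the dual space -/

section Polarization

variable {E F : Type*} [AddCommGroup E] [Module ℝ E] [AddCommGroup F] [Module ℝ F]

/-- The sum of a multilinear map over all the permutations of its arguments. -/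
def permSum {d : ℕ} (A : MultilinearMap ℝ (fun _ : Fin d => E) F) :
    MultilinearMap ℝ (fun _ : Fin d => E) F :=
  ∑ σ : Equiv.Perm (Fin d), A.domDomCongr σ

theorem permSum_apply {d : ℕ} (A : MultilinearMap ℝ (fun _ : Fin d => E) F) (v : Fin d → E) :
    permSum A v = ∑ σ : Equiv.Perm (Fin d), A (fun i => v (σ i)) := by
  simp [permSum]

theorem permSum_diag {d : ℕ} (A : MultilinearMap ℝ (fun _ : Fin d => E) ℝ) (x : E) :
    permSum A (fun _ => x) = d.factorial * A (fun _ => x) := by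
  simp [permSum_apply, Fintype.card_perm]

theorem sum_powerset_ite_mapsTo {d : ℕ} (r : Fin d → Fin d) :
    ∑ S ∈ (univ : Finset (Fin d)).powerset,
      (if ∀ i, r i ∈ S then (-1 : ℝ) ^ (d + #S) else 0) =
      if Function.Surjective r then 1 else 0 := by
  split_ifs with hr
  · rw [Finset.sum_eq_single univ]
    · simp [← two_mul]
    · intro S _ hS
      rw [if_neg]
      intro h
      refine hS (Finset.eq_univ_iff_forall.2 fun i => ?_)
      obtain ⟨k, rfl⟩ := hr i
      exact h k
    · simp
  · simp only [Function.Surjective, not_forall, not_exists] at hr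
    obtain ⟨a, ha⟩ := hr
    rw [← Finset.insert_erase (Finset.mem_univ a), Finset.sum_powerset_insert (by simp),
      ← Finset.sum_add_distrib]
    refine Finset.sum_eq_zero fun S hS => ?_
    have haS : a ∉ S := fun h => by simpa using Finset.mem_powerset.1 hS h
    have : (∀ i, r i ∈ insert a S) ↔ ∀ i, r i ∈ S := by simp [ha]
    simp only [this, Finset.card_insert_of_notMem haS]
    split_ifs
    · rw [← add_assoc, pow_succ]; ring
    · simp

/-- The polarization formula. -/
theorem permSum_eq_sum_powerset {d : ℕ} (A : MultilinearMap ℝ (fun _ : Fin d => E) ℝ)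
    (v : Fin d → E) :
    permSum A v = ∑ S ∈ (univ : Finset (Fin d)).powerset,
      (-1 : ℝ) ^ (d + #S) * A (fun _ => ∑ i ∈ S, v i) := by
  have h1 : ∀ S : Finset (Fin d), A (fun _ => ∑ i ∈ S, v i) =
      ∑ r : Fin d → Fin d, if ∀ i, r i ∈ S then A (fun i => v (r i)) else 0 := by
    intro S
    rw [A.map_sum_finset (fun _ j => v j) (fun _ => S), ← Finset.sum_filter]
    refine Finset.sum_congr ?_ fun _ _ => rfl
    ext r
    simp [Fintype.mem_piFinset]
  have h2 : ∀ r : Fin d → Fin d, ∑ S ∈ (univ : Finset (Fin d)).powerset,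
      (-1 : ℝ) ^ (d + #S) * (if ∀ i, r i ∈ S then A (fun i => v (r i)) else 0) =
      if Function.Surjective r then A (fun i => v (r i)) else 0 := by
    intro r
    have := congrArg (· * A (fun i => v (r i))) (sum_powerset_ite_mapsTo r)
    simp only [Finset.sum_mul, ite_mul, one_mul, zero_mul] at this
    rw [← this]
    exact Finset.sum_congr rfl fun S _ => by split_ifs <;> simp
  simp only [h1, Finset.mul_sum]
  rw [Finset.sum_comm, Finset.sum_congr rfl fun r _ => h2 r, ← Finset.sum_filter, permSum_apply]
  refine Finset.sum_bij (fun σ _ => (σ : Fin d → Fin d)) ?_ ?_ ?_ fun _ _ => rfl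
  · intro σ _
    simpa using σ.surjective
  · intro σ _ τ _ h
    exact DFunLike.coe_injective h
  · intro r hr
    have hr' : Function.Surjective r := by simpa using hr
    exact ⟨Equiv.ofBijective r ⟨Finite.injective_iff_surjective.2 hr', hr'⟩, by simp, rfl⟩

end Polarization

section Projection

variable {X : Type u} [NormedAddCommGroup X] [NormedSpace ℝ X]

variable (X) in
/-- The Banach space of bounded real functions on the unit ball of `X`, in which the dual of `X`
embeds isometrically by restriction. -/
abbrev BallFun : Type u := lp (fun _ : closedBall (0 : X) 1 => ℝ) ∞

/-- A bounded function on the unit ball, as an element of `BallFun X`. -/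
def ballFun (F : X → ℝ) (hF : ∃ B, ∀ z ∈ closedBall (0 : X) 1, |F z| ≤ B) : BallFun X :=
  ⟨fun z => F z, memℓp_infty ⟨hF.choose, by
    rintro _ ⟨z, rfl⟩
    exact hF.choose_spec z z.2⟩⟩

theorem strongDual_bounded (l : StrongDual ℝ X) :
    ∀ z ∈ closedBall (0 : X) 1, |l z| ≤ ‖l‖ := by
  intro z hz
  exact (l.le_opNorm z).trans
    (mul_le_of_le_one_right (norm_nonneg _) (mem_closedBall_zero_iff.1 hz))

variable (X) in
/-- The restriction of the functionals to the unit ball. -/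
def restrictBall : StrongDual ℝ X →ₗᵢ[ℝ] BallFun X where
  toFun l := ballFun l ⟨‖l‖, strongDual_bounded l⟩
  map_add' _ _ := rfl
  map_smul' _ _ := rfl
  norm_map' l := by
    refine le_antisymm
      (lp.norm_le_of_forall_le (norm_nonneg _) fun z => strongDual_bounded l z z.2) ?_
    refine l.opNorm_le_of_unit_norm (norm_nonneg _) fun z hz => ?_
    exact lp.norm_apply_le_norm ENNReal.top_ne_zero (ballFun l ⟨‖l‖, strongDual_bounded l⟩)
      ⟨z, mem_closedBall_zero_iff.2 hz.le⟩

theorem exists_projection {c : ℝ≥0} (hc : IsProjectionBound (StrongDual ℝ X) c) :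
    ∃ P : BallFun X →L[ℝ] StrongDual ℝ X, (∀ l, P (restrictBall X l) = l) ∧ ‖P‖ ≤ c :=
  hc (BallFun X) (restrictBall X)

theorem abs_projection_sub_le {c : ℝ≥0} {P : BallFun X →L[ℝ] StrongDual ℝ X} (hP : ‖P‖ ≤ c)
    {F G : BallFun X} {D : ℝ} (hD : 0 ≤ D)
    (hFG : ∀ z : closedBall (0 : X) 1, |F z - G z| ≤ D) {x : X} (hx : x ∈ closedBall (0 : X) 1) :
    |P F x - P G x| ≤ c * D := by
  have h1 : ‖F - G‖ ≤ D := lp.norm_le_of_forall_le hD hFG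
  calc |P F x - P G x| = |P (F - G) x| := by simp
    _ ≤ ‖P (F - G)‖ := strongDual_bounded _ x hx
    _ ≤ ‖P‖ * ‖F - G‖ := P.le_opNorm _
    _ ≤ c * D := by gcongr

/-- Applying a projection to the parameter of a bounded family of `d`-homogeneous polynomials, and
evaluating the functional so obtained at the variable, yields a `(d + 1)`-homogeneous polynomial.
The polarization formula carries boundedness over from the diagonal to the multilinear maps. -/
theorem projection_mem_polynomials {d : ℕ} (P : BallFun X →L[ℝ] StrongDual ℝ X)
    (A : X → MultilinearMap ℝ (fun _ : Fin d => X) ℝ)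
    (hA : ∀ h : X, ∃ B, ∀ z ∈ closedBall (0 : X) 1, |A z (fun _ => h)| ≤ B) :
    (fun h => P (ballFun (fun z => A z fun _ => h) (hA h)) h) ∈ polynomials X (d + 1) := by
  have hS : ∀ v : Fin d → X, ∃ B, ∀ z ∈ closedBall (0 : X) 1, |permSum (A z) v| ≤ B := by
    intro v
    choose B hB using hA
    refine ⟨∑ S ∈ (univ : Finset (Fin d)).powerset, B (∑ i ∈ S, v i), fun z hz => ?_⟩
    rw [permSum_eq_sum_powerset]
    refine (Finset.abs_sum_le_sum_abs _ _).trans (Finset.sum_le_sum fun S _ => ?_)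
    rw [abs_mul, abs_pow, abs_neg, abs_one, one_pow, one_mul]
    exact hB _ z hz
  let N : MultilinearMap ℝ (fun _ : Fin d => X) (BallFun X) :=
    { toFun := fun v => ballFun (fun z => permSum (A z) v) (hS v)
      map_update_add' := fun v i x y => by
        refine lp.ext (funext fun z => ?_)
        exact (permSum (A z)).map_update_add v i x y
      map_update_smul' := fun v i a x => by
        refine lp.ext (funext fun z => ?_)
        exact (permSum (A z)).map_update_smul v i a x }
  let T : MultilinearMap ℝ (fun _ : Fin (d + 1) => X) ℝ :=
    (((ContinuousLinearMap.coeLM ℝ : StrongDual ℝ X →ₗ[ℝ] X →ₗ[ℝ] ℝ).comp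
      (P : BallFun X →ₗ[ℝ] StrongDual ℝ X)).compMultilinearMap N).uncurryRight
  have hT : ∀ h : X, (d.factorial : ℝ)⁻¹ * T (fun _ => (1 : ℝ) • h) =
      P (ballFun (fun z => A z fun _ => h) (hA h)) h := by
    intro h
    have e : N (fun _ => h) = (d.factorial : ℝ) • ballFun (fun z => A z fun _ => h) (hA h) :=
      lp.ext (funext fun z => permSum_diag (A z) h)
    have e2 : T (fun _ => (1 : ℝ) • h) = P (N fun _ => h) h := by
      rw [one_smul]; rfl
    rw [e2, e, map_smul, smul_apply, smul_eq_mul,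
      inv_mul_cancel_left₀ (by positivity)]
  simpa only [hT] using polynomials_smul_comp_smul (polynomials_diag T) (d.factorial : ℝ)⁻¹ 1

end Projection

/-! ### Splitting off the part of highest degree, and extrapolation -/

section

variable {E : Type*} [AddCommGroup E] [Module ℝ E]

theorem fwdDiff_commute {E : Type*} [AddCommGroup E] (a b : E) :
    Function.Commute (fwdDiff a : (E → ℝ) → E → ℝ) (fwdDiff b) := by
  intro f
  funext x
  simp only [fwdDiff, add_right_comm x b a]
  ring

theorem fwdDiff_natCast_smul (i : ℕ) (h : E) (f : E → ℝ) (y : E) :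
    fwdDiff ((i : ℝ) • h) f y = ∑ a ∈ range i, fwdDiff h f (y + (a : ℝ) • h) := by
  have := Finset.sum_range_sub (fun a : ℕ => f (y + (a : ℝ) • h)) i
  simp only [Nat.cast_zero, zero_smul, add_zero] at this
  rw [fwdDiff, ← this]
  refine Finset.sum_congr rfl fun a _ => ?_
  rw [fwdDiff, add_assoc, Nat.cast_succ, add_smul, one_smul]

/-- Passing from the step `h` to the step `i h` multiplies an almost constant `n`-th difference
by `i ^ n`. -/
theorem abs_fwdDiff_iter_natCast_smul_sub_le {h : E} {i : ℕ} {c C : ℝ} (n : ℕ) (f : E → ℝ) (y : E)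
    (hf : ∀ k ≤ n * i, |(fwdDiff h)^[n] f (y + (k : ℝ) • h) - c| ≤ C) :
    |(fwdDiff ((i : ℝ) • h))^[n] f y - (i : ℝ) ^ n * c| ≤ (i : ℝ) ^ n * C := by
  induction n generalizing f y with
  | zero => simpa using hf 0 (Nat.zero_le _)
  | succ n ih =>
    have e : (fwdDiff ((i : ℝ) • h))^[n + 1] f y - (i : ℝ) ^ (n + 1) * c =
        ∑ a ∈ range i, ((fwdDiff ((i : ℝ) • h))^[n] (fwdDiff h f) (y + (a : ℝ) • h) -
          (i : ℝ) ^ n * c) := by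
      rw [Function.iterate_succ_apply', fwdDiff_natCast_smul, Finset.sum_sub_distrib,
        Finset.sum_const, card_range, nsmul_eq_mul, pow_succ,
        ((fwdDiff_commute h ((i : ℝ) • h)).iterate_right n).eq]
      ring
    rw [e]
    refine (Finset.abs_sum_le_sum_abs _ _).trans
      ((Finset.sum_le_card_nsmul _ _ ((i : ℝ) ^ n * C) fun a ha => ?_).trans ?_)
    · refine ih _ _ fun k hk => ?_
      have := hf (a + k) (by have := mem_range.1 ha; rw [Nat.succ_mul]; omega)
      rw [Nat.cast_add, add_smul, ← add_assoc, Function.iterate_succ_apply] at this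
      exact this
    · rw [card_range, nsmul_eq_mul, pow_succ]
      exact (by ring : (i : ℝ) * ((i : ℝ) ^ n * C) = (i : ℝ) ^ n * i * C).le

theorem fwdDiff_iter_diag (n : ℕ) (f : E → ℝ) (x h : E) :
    (fwdDiff h)^[n] (fun x => (fwdDiff x)^[n] f 0) x =
      ∑ i ∈ range (n + 1), (-1 : ℝ) ^ (n - i) * (n.choose i : ℝ) *
        (fwdDiff ((i : ℝ) • h))^[n] f ((i : ℝ) • x) := by
  simp only [fwdDiff_iter_eq_sum, Finset.mul_sum]
  rw [Finset.sum_comm]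
  refine Finset.sum_congr rfl fun i _ => Finset.sum_congr rfl fun j _ => ?_
  rw [zero_add, smul_add, smul_comm (j : ℝ) (i : ℝ)]
  ring

end

section

variable {X : Type u} [NormedAddCommGroup X] [NormedSpace ℝ X]

theorem DiffBound.abs_fwdDiff_fwdDiff_le {p q m : ℕ} (hm : p + q = m) {f : X → ℝ}
    (hf : DiffBound m 1 1 f)
    {a b x : X} (hx : ‖x‖ + (p + q + 1) * (p * ‖a‖ + q * ‖b‖) ≤ 1) :
    |(fwdDiff b)^[q] ((fwdDiff a)^[p] f) x| ≤ 2 ^ m := by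
  subst hm
  exact Whitney.abs_fwdDiff_fwdDiff_le hf hx

theorem norm_le_of_segment {n : ℕ} (hn : 1 ≤ n) {ρ : ℝ} {x h : X}
    (hxh : ∀ j : ℕ, j ≤ n → x + (j : ℝ) • h ∈ closedBall (0 : X) ρ) :
    ‖x‖ ≤ ρ ∧ ‖h‖ ≤ 2 * ρ := by
  have h0 : ‖x‖ ≤ ρ := by simpa using hxh 0 (Nat.zero_le _)
  have h1 : ‖x + h‖ ≤ ρ := by simpa using hxh 1 hn
  refine ⟨h0, ?_⟩
  calc ‖h‖ = ‖(x + h) - x‖ := by rw [add_sub_cancel_left]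
    _ ≤ ‖x + h‖ + ‖x‖ := norm_sub_le _ _
    _ ≤ 2 * ρ := by linarith

theorem continuousOn_fwdDiff_iter {d : ℕ} {f : X → ℝ} (hf : ContinuousOn f (closedBall 0 1))
    {ρ : ℝ} {h : X} (hh : ρ + d * ‖h‖ ≤ 1) :
    ContinuousOn ((fwdDiff h)^[d] f) (closedBall 0 ρ) := by
  have : (fwdDiff h)^[d] f = fun x => ∑ j ∈ range (d + 1),
      (-1 : ℝ) ^ (d - j) * (d.choose j : ℝ) * f (x + (j : ℝ) • h) :=
    funext fun x => fwdDiff_iter_eq_sum d h f x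
  rw [this]
  refine continuousOn_finsetSum _ fun j hj => continuousOn_const.mul (hf.comp (by fun_prop) ?_)
  intro x hx
  have hj' : (j : ℝ) ≤ d := by exact_mod_cast Nat.lt_succ_iff.1 (mem_range.1 hj)
  rw [mem_closedBall_zero_iff] at hx ⊢
  calc ‖x + (j : ℝ) • h‖ ≤ ‖x‖ + j * ‖h‖ := by
        refine (norm_add_le _ _).trans_eq ?_
        rw [norm_smul, Real.norm_natCast]
    _ ≤ ρ + d * ‖h‖ := by gcongr
    _ ≤ 1 := hh

theorem continuousOn_fwdDiff_iter_diag {n : ℕ} {f : X → ℝ} (hf : ContinuousOn f (closedBall 0 1))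
    {ρ : ℝ} (hρ : n * ρ ≤ 1) :
    ContinuousOn (fun x => (fwdDiff x)^[n] f 0) (closedBall 0 ρ) := by
  simp only [fwdDiff_iter_eq_sum]
  refine continuousOn_finsetSum _ fun j hj => continuousOn_const.mul (hf.comp (by fun_prop) ?_)
  intro x hx
  have hj' : (j : ℝ) ≤ n := by exact_mod_cast Nat.lt_succ_iff.1 (mem_range.1 hj)
  rw [mem_closedBall_zero_iff] at hx ⊢
  simp only [zero_add, norm_smul, Real.norm_natCast]
  calc (j : ℝ) * ‖x‖ ≤ n * ρ := by gcongr
    _ ≤ 1 := hρ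

/-- Subtracting the almost homogeneous part `Δ_x^n f 0 / n!` of degree `n` lowers by one the order
of the differences of `f` that are bounded. -/
theorem diffBound_sub_diag {n : ℕ} (hn : 1 ≤ n) {f : X → ℝ} (hf : DiffBound (n + 1) 1 1 f)
    {ρ : ℝ} (hρ : 10 * ((n : ℝ) + 1) ^ 3 * ρ = 1) :
    DiffBound n ρ (2 ^ n * ((n : ℝ) ^ n * 2 ^ (n + 1)))
      (fun x => f x - (n.factorial : ℝ)⁻¹ * (fwdDiff x)^[n] f 0) := by
  have hρ0 : 0 < ρ := by
    by_contra! h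
    have : 10 * ((n : ℝ) + 1) ^ 3 * ρ ≤ 0 := mul_nonpos_of_nonneg_of_nonpos (by positivity) h
    linarith
  intro x h hxh
  obtain ⟨hx, hh⟩ := norm_le_of_segment hn hxh
  have hclose : ∀ i ≤ n, ∀ k ≤ n * i,
      |(fwdDiff h)^[n] f ((i : ℝ) • x + (k : ℝ) • h) - (fwdDiff h)^[n] f x| ≤ 2 ^ (n + 1) := by
    intro i hi k hk
    have hi' : (i : ℝ) ≤ n := by exact_mod_cast hi
    have hk' : (k : ℝ) ≤ n * n := by exact_mod_cast hk.trans (Nat.mul_le_mul_left n hi)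
    have hb : ‖(i : ℝ) • x + (k : ℝ) • h - x‖ ≤ n * ρ + n * n * (2 * ρ) + ρ := by
      refine (norm_sub_le _ _).trans (add_le_add ((norm_add_le _ _).trans ?_) hx)
      rw [norm_smul, norm_smul, Real.norm_natCast, Real.norm_natCast]
      gcongr
    have := hf.abs_fwdDiff_fwdDiff_le (p := n) (q := 1) rfl
      (a := h) (b := (i : ℝ) • x + (k : ℝ) • h - x) (x := x) ?_
    · simpa [fwdDiff] using this
    · calc ‖x‖ + ((n : ℝ) + (1 : ℕ) + 1) *
            (n * ‖h‖ + (1 : ℕ) * ‖(i : ℝ) • x + (k : ℝ) • h - x‖)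
          ≤ ρ + ((n : ℝ) + (1 : ℕ) + 1) *
            (n * (2 * ρ) + (1 : ℕ) * (n * ρ + n * n * (2 * ρ) + ρ)) := by gcongr
        _ = 10 * ((n : ℝ) + 1) ^ 3 * ρ - (8 * n ^ 3 + 23 * n ^ 2 + 23 * n + 7) * ρ := by
            push_cast; ring
        _ ≤ 1 := by
            rw [hρ]
            have : 0 ≤ (8 * (n : ℝ) ^ 3 + 23 * n ^ 2 + 23 * n + 7) * ρ := by positivity
            linarith
  have hdiag : |(fwdDiff h)^[n] (fun x => (fwdDiff x)^[n] f 0) x -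
      n.factorial * (fwdDiff h)^[n] f x| ≤ 2 ^ n * ((n : ℝ) ^ n * 2 ^ (n + 1)) := by
    rw [fwdDiff_iter_diag, ← sum_choose_pow_eq_factorial, Finset.sum_mul,
      ← Finset.sum_sub_distrib, ← sum_choose_abs, Finset.sum_mul]
    refine (Finset.abs_sum_le_sum_abs _ _).trans (Finset.sum_le_sum fun i hi => ?_)
    have hi' : i ≤ n := Nat.lt_succ_iff.1 (mem_range.1 hi)
    rw [mul_assoc _ ((i : ℝ) ^ n), ← mul_sub, abs_mul]
    refine mul_le_mul_of_nonneg_left ?_ (abs_nonneg _)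
    refine (abs_fwdDiff_iter_natCast_smul_sub_le n f _ (hclose i hi')).trans ?_
    gcongr
  have e : (fwdDiff h)^[n] (fun x => f x - (n.factorial : ℝ)⁻¹ * (fwdDiff x)^[n] f 0) x =
      -((n.factorial : ℝ)⁻¹ * ((fwdDiff h)^[n] (fun x => (fwdDiff x)^[n] f 0) x -
        n.factorial * (fwdDiff h)^[n] f x)) := by
    have : (fun x => f x - (n.factorial : ℝ)⁻¹ * (fwdDiff x)^[n] f 0) =
        f + (-(n.factorial : ℝ)⁻¹) • fun x => (fwdDiff x)^[n] f 0 := by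
      funext y; simp [sub_eq_add_neg]
    rw [this, fwdDiff_iter_add, fwdDiff_iter_const_smul, Pi.add_apply, Pi.smul_apply, smul_eq_mul,
      mul_sub, inv_mul_cancel_left₀ (by positivity)]
    ring
  rw [e, abs_neg, abs_mul, abs_of_pos (by positivity)]
  refine (mul_le_of_le_one_left (abs_nonneg _) (inv_le_one_of_one_le₀ ?_)).trans hdiag
  exact_mod_cast n.factorial_pos

/-- A function with bounded differences that is bounded on a small ball is bounded on the unit ball:
the difference of step `x / m` at the origin expresses the value at `x` through values at points
of norm at most `(1 - 1 / m) ‖x‖`. -/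
theorem abs_le_of_abs_le_small {m : ℕ} (hm : 1 ≤ m) {g : X → ℝ}
    (hg : ∀ h : X, ‖(m : ℝ) • h‖ ≤ 1 → |(fwdDiff h)^[m] g 0| ≤ 1) {r D : ℝ} (hD : 1 ≤ D)
    (hr : ∀ x : X, ‖x‖ ≤ r → ‖x‖ ≤ 1 → |g x| ≤ D) (i : ℕ) (x : X)
    (hx : (1 - (m : ℝ)⁻¹) ^ i * ‖x‖ ≤ r) (hx1 : ‖x‖ ≤ 1) : |g x| ≤ (2 ^ m + 1) ^ i * D := by
  have hm0 : (0 : ℝ) < m := by exact_mod_cast hm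
  have ht : 0 ≤ 1 - (m : ℝ)⁻¹ := sub_nonneg.2 (inv_le_one_of_one_le₀ (by exact_mod_cast hm))
  induction i generalizing x with
  | zero => simpa using hr x (by simpa using hx) hx1
  | succ i ih =>
    have hmx : (m : ℝ) • (m : ℝ)⁻¹ • x = x := smul_inv_smul₀ hm0.ne' x
    have h1 := hg ((m : ℝ)⁻¹ • x) (by rwa [hmx])
    rw [fwdDiff_iter_eq_sum, Finset.sum_range_succ] at h1
    simp only [zero_add, hmx, Nat.sub_self, pow_zero, Nat.choose_self, Nat.cast_one, one_mul] at h1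
    have h2 : |∑ j ∈ range m, (-1 : ℝ) ^ (m - j) * (m.choose j : ℝ) * g ((j : ℝ) • (m : ℝ)⁻¹ • x)| ≤
        2 ^ m * ((2 ^ m + 1) ^ i * D) := by
      obtain ⟨Q, hQ⟩ : ∃ Q, Q = (2 ^ m + 1) ^ i * D := ⟨_, rfl⟩
      have hQ0 : 0 ≤ Q := by rw [hQ]; positivity
      rw [← hQ, ← sum_choose_abs, Finset.sum_mul]
      refine (Finset.abs_sum_le_sum_abs _ _).trans ((Finset.sum_le_sum fun j hj => ?_).trans
        (Finset.sum_le_sum_of_subset_of_nonneg (Finset.range_subset_range.2 (Nat.le_succ m))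
          fun _ _ _ => by positivity))
      rw [abs_mul]
      refine mul_le_mul_of_nonneg_left ?_ (abs_nonneg _)
      have hj' : (j : ℝ) * (m : ℝ)⁻¹ ≤ 1 - (m : ℝ)⁻¹ := by
        have : (j : ℝ) + 1 ≤ m := by exact_mod_cast mem_range.1 hj
        have h3 := mul_le_mul_of_nonneg_right this (inv_nonneg.2 hm0.le)
        rw [mul_inv_cancel₀ hm0.ne'] at h3
        linarith
      have hn : ‖(j : ℝ) • (m : ℝ)⁻¹ • x‖ ≤ (1 - (m : ℝ)⁻¹) * ‖x‖ := by
        rw [smul_smul, norm_smul, Real.norm_of_nonneg (by positivity)]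
        gcongr
      rw [hQ]
      refine ih _ ?_ ?_
      · refine le_trans ?_ hx
        rw [pow_succ, mul_assoc]
        gcongr
      · refine hn.trans ((mul_le_of_le_one_left (norm_nonneg _) ?_).trans hx1)
        linarith [inv_pos.2 hm0]
    have h4 : (1 : ℝ) ≤ (2 ^ m + 1) ^ i * D :=
      one_le_mul_of_one_le_of_one_le (one_le_pow₀ (by linarith [pow_pos (two_pos (α := ℝ)) m])) hD
    calc |g x| ≤ 1 + 2 ^ m * ((2 ^ m + 1) ^ i * D) := by
          have := abs_le.1 h1
          have := abs_le.1 h2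
          exact abs_le.2 ⟨by linarith, by linarith⟩
      _ ≤ (2 ^ m + 1) ^ (i + 1) * D := by rw [pow_succ]; nlinarith

end

/-! ### Approximation of the part of highest degree -/

/-- A function with bounded differences is approximated near the origin, as regards its almost
homogeneous part `Δ_h^(d + 1) f 0`, by a homogeneous polynomial. The difference `Δ_h^d f` is almost
affine, hence close to a linear functional, and is therefore almost reproduced by the projection
`P`; on the other hand it is, at any point `ρ z`, close to a `d`-homogeneous polynomial of `h`. -/
theorem exists_top_approx (d : ℕ) (hd : 1 ≤ d) {ρ : ℝ}
    (hρ : 10 * (((d + 1 : ℕ) : ℝ) + 1) ^ 3 * ρ = 1) :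
    ∃ K : ℝ, 0 < K ∧ ∀ (X : Type u) [NormedAddCommGroup X] [NormedSpace ℝ X]
      [FiniteDimensional ℝ X] (W : ℝ) (c : ℝ≥0),
      whitneyConstSpace X (d + 1) < ENNReal.ofReal W → 1 ≤ c →
      IsProjectionBound (StrongDual ℝ X) c →
      ∀ f : X → ℝ, ContinuousOn f (closedBall 0 1) → DiffBound (d + 2) 1 1 f →
      ∃ Ψ ∈ polynomials X (d + 1), ∀ h : X, ‖h‖ ≤ ρ / (d + 1) →
        |(fwdDiff h)^[d + 1] f 0 - Ψ h| ≤ K * c * (1 + W) := by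
  obtain ⟨K, hK, hlin⟩ := exists_linear_approx.{u} d hd
  have hρ0 : 0 < ρ := by
    by_contra! h
    have : 10 * (((d + 1 : ℕ) : ℝ) + 1) ^ 3 * ρ ≤ 0 :=
      mul_nonpos_of_nonneg_of_nonpos (by positivity) h
    linarith
  -- The points of all the differences used below lie in the unit ball by this inequality.
  have hsmall : ρ + ((d : ℝ) + 3) * ((d + 1) * (2 * ρ) + 2 * (2 * ρ)) ≤ 1 := by
    have : 0 ≤ (10 * (d : ℝ) ^ 3 + 58 * d ^ 2 + 108 * d + 61) * ρ := by positivity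
    push_cast at hρ
    linarith
  have hd0 : (0 : ℝ) ≤ d := Nat.cast_nonneg d
  have hprod : ∀ a b s t : ℝ, 0 ≤ a → a ≤ d + 1 → 0 ≤ b → b ≤ 2 → s ≤ 2 * ρ → t ≤ 2 * ρ →
      0 ≤ s → 0 ≤ t → ρ + ((d : ℝ) + 3) * (a * s + b * t) ≤ 1 := by
    intro a b s t ha ha' hb hb' hs ht hs0 ht0
    refine le_trans ?_ hsmall
    gcongr
  have hρd : ρ / (d + 1) ≤ ρ := div_le_self hρ0.le (by linarith)
  have hρ1 : ρ + ρ ≤ 1 := by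
    have := hprod 1 0 ρ 0 zero_le_one (by linarith) le_rfl two_pos.le (by linarith) (by linarith)
      hρ0.le le_rfl
    nlinarith
  refine ⟨2 * (K * 2 ^ (d + 2)) + 2 ^ d * 2 ^ (d + 2), by positivity, ?_⟩
  intro X _ _ _ W c hW hc hproj f hfc hf
  have hWpos : 0 < W := ENNReal.ofReal_pos.1 (bot_lt_of_lt hW)
  have hc' : (1 : ℝ) ≤ c := by exact_mod_cast hc
  have hscale : ∀ z ∈ closedBall (0 : X) 1, ρ • z ∈ closedBall (0 : X) ρ := by
    intro z hz
    rw [mem_closedBall_zero_iff] at hz ⊢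
    rw [norm_smul, Real.norm_of_nonneg hρ0.le]
    exact mul_le_of_le_one_right hρ0.le hz
  obtain ⟨P, hP, hPc⟩ := exists_projection hproj
  -- For a fixed translate, the increment of `f` is close to a polynomial of degree `d`.
  have hpoly : ∀ z : X, ∃ A : (j : ℕ) → MultilinearMap ℝ (fun _ : Fin j => X) ℝ,
      z ∈ closedBall (0 : X) 1 → ∀ x ∈ closedBall (0 : X) ρ,
        |f (x + ρ • z) - f x - ∑ j ∈ range (d + 1), A j (fun _ => x)| ≤ W * 2 ^ (d + 2) := by
    intro z
    by_cases hz : z ∈ closedBall (0 : X) 1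
    · have hzρ := mem_closedBall_zero_iff.1 (hscale z hz)
      have hcont : ContinuousOn (fwdDiff (ρ • z) f) (closedBall 0 ρ) :=
        continuousOn_fwdDiff_iter (d := 1) hfc (by rw [Nat.cast_one, one_mul]; linarith)
      have hbd : DiffBound (d + 1) ρ (2 ^ (d + 2)) (fwdDiff (ρ • z) f) := by
        intro x h hxh
        obtain ⟨hx, hh⟩ := norm_le_of_segment (by omega) hxh
        rw [← ((fwdDiff_commute (ρ • z) h).iterate_right (d + 1)).eq]
        refine hf.abs_fwdDiff_fwdDiff_le (p := d + 1) (q := 1) rfl ?_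
        have := hprod (d + 1) 1 ‖h‖ ‖ρ • z‖ (by linarith) le_rfl zero_le_one one_le_two hh
          (by linarith) (norm_nonneg _) (norm_nonneg _)
        push_cast
        rw [show (d : ℝ) + 1 + 1 + 1 = d + 3 by ring]
        linarith
      obtain ⟨p, ⟨A, hA⟩, hp⟩ := exists_polynomial_approx hW hρ0 (by positivity) hcont hbd
      refine ⟨A, fun _ x hx => ?_⟩
      have := hp x hx
      rw [hA] at this
      exact this
    · exact ⟨0, fun h => absurd h hz⟩
  choose A hA using hpoly
  set B : X → MultilinearMap ℝ (fun _ : Fin d => X) ℝ := fun z => (d.factorial : ℝ) • A z d with hB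
  set q : X → X → ℝ := fun h z => (fwdDiff h)^[d] f (ρ • z) - (fwdDiff h)^[d] f 0 with hq
  have hqB : ∀ h : X, ‖h‖ ≤ ρ / (d + 1) → ∀ z ∈ closedBall (0 : X) 1,
      |q h z - B z (fun _ => h)| ≤ 2 ^ d * (W * 2 ^ (d + 2)) := by
    intro h hh z hz
    have e : q h z - B z (fun _ => h) = (fwdDiff h)^[d] ((fun x => f (x + ρ • z)) +
        (-1 : ℝ) • f + (-1 : ℝ) • fun x => ∑ j ∈ range (d + 1), A z j (fun _ => x)) 0 := by
      rw [fwdDiff_iter_add, fwdDiff_iter_add, fwdDiff_iter_const_smul, fwdDiff_iter_const_smul]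
      simp only [Pi.add_apply, Pi.smul_apply]
      rw [fwdDiff_iter_comp_add, fwdDiff_iter_polynomial_zero d (A z) _ fun _ => rfl]
      simp [hq, hB, sub_eq_add_neg]
    rw [e]
    refine abs_fwdDiff_iter_le fun j hj => ?_
    have hj' : (j : ℝ) ≤ d := by exact_mod_cast hj
    have := hA z hz (0 + (j : ℝ) • h) ?_
    · simpa [sub_eq_add_neg] using this
    · rw [mem_closedBall_zero_iff, zero_add, norm_smul, Real.norm_natCast]
      calc (j : ℝ) * ‖h‖ ≤ (d + 1) * (ρ / (d + 1)) := by gcongr; linarith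
        _ = ρ := by field_simp
  have hqbd : ∀ h : X, ‖h‖ ≤ ρ / (d + 1) → ∃ S, ∀ z ∈ closedBall (0 : X) 1, |q h z| ≤ S := by
    intro h hh
    have hcont : ContinuousOn ((fwdDiff h)^[d] f) (closedBall 0 ρ) := by
      refine continuousOn_fwdDiff_iter hfc ?_
      have := hprod d 0 ‖h‖ 0 hd0 (by linarith) le_rfl two_pos.le (by linarith) (by linarith)
        (norm_nonneg _) le_rfl
      have : 0 ≤ (d : ℝ) * ‖h‖ := by positivity
      nlinarith
    obtain ⟨S, hS⟩ := (isCompact_closedBall (0 : X) ρ).exists_bound_of_continuousOn hcont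
    refine ⟨S + S, fun z hz => (abs_sub _ _).trans (add_le_add ?_ ?_)⟩
    · exact hS _ (hscale z hz)
    · exact hS _ (mem_closedBall_self hρ0.le)
  have hBbd : ∀ h : X, ∃ S, ∀ z ∈ closedBall (0 : X) 1, |B z (fun _ => h)| ≤ S := by
    intro h
    set t : ℝ := ρ / (d + 1) / (‖h‖ + 1) with ht
    have ht0 : 0 < t := by positivity
    have hth : ‖t • h‖ ≤ ρ / (d + 1) := by
      rw [norm_smul, Real.norm_of_nonneg ht0.le, ht, div_mul_eq_mul_div]
      refine div_le_of_le_mul₀ (by positivity) (by positivity) ?_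
      gcongr
      linarith
    obtain ⟨S, hS⟩ := hqbd _ hth
    refine ⟨(t ^ d)⁻¹ * (2 ^ d * (W * 2 ^ (d + 2)) + S), fun z hz => ?_⟩
    have h1 := hqB _ hth z hz
    have h2 := hS z hz
    rw [multilinear_diag_smul] at h1
    rw [le_inv_mul_iff₀ (by positivity), ← abs_of_pos (pow_pos ht0 d), ← abs_mul]
    calc |t ^ d * B z fun _ => h|
        = |q (t • h) z - (q (t • h) z - t ^ d * B z fun _ => h)| := by rw [sub_sub_cancel]
      _ ≤ _ := (abs_sub _ _).trans (by linarith)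
  refine ⟨fun h => ρ⁻¹ * P (ballFun (fun z => B z fun _ => h) (hBbd h)) ((1 : ℝ) • h), ?_,
    fun h hh => ?_⟩
  · have := polynomials_smul_comp_smul (projection_mem_polynomials P B hBbd) ρ⁻¹ 1
    simpa only [one_smul] using this
  have hhρ : ‖h‖ ≤ ρ := hh.trans hρd
  have hlinear : ∃ l : StrongDual ℝ X, ∀ z ∈ closedBall (0 : X) ρ,
      |((fwdDiff h)^[d] f z - (fwdDiff h)^[d] f 0) - l z| ≤ K * (1 + W) * 2 ^ (d + 2) := by
    refine hlin X W hW ρ _ _ hρ0 (by positivity) ?_ (sub_self _) ?_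
    · refine (continuousOn_fwdDiff_iter hfc ?_).sub continuousOn_const
      have := hprod d 0 ‖h‖ 0 hd0 (by linarith) le_rfl two_pos.le (by linarith) (by linarith)
        (norm_nonneg _) le_rfl
      have : 0 ≤ (d : ℝ) * ‖h‖ := by positivity
      nlinarith
    · intro x z hxz
      obtain ⟨hx, hz⟩ := norm_le_of_segment (by omega) hxz
      have e : (fwdDiff z)^[2] (fun x => (fwdDiff h)^[d] f x - (fwdDiff h)^[d] f 0) x =
          (fwdDiff z)^[2] ((fwdDiff h)^[d] f) x := by
        simp only [Function.iterate_succ, Function.iterate_zero, Function.comp, id, fwdDiff]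
        ring
      rw [e]
      refine hf.abs_fwdDiff_fwdDiff_le (p := d) (q := 2) rfl ?_
      have := hprod d 2 ‖h‖ ‖z‖ hd0 (by linarith) two_pos.le le_rfl (by linarith) hz
        (norm_nonneg _) (norm_nonneg _)
      push_cast
      rw [show (d : ℝ) + 2 + 1 = d + 3 by ring]
      linarith
  obtain ⟨l, hl⟩ := hlinear
  have hl' : ∀ z ∈ closedBall (0 : X) 1, |q h z - (ρ • l) z| ≤ K * (1 + W) * 2 ^ (d + 2) := by
    intro z hz
    have := hl _ (hscale z hz)
    rwa [map_smul] at this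
  set x : X := ρ⁻¹ • h with hx
  have hx1 : x ∈ closedBall (0 : X) 1 := by
    rw [mem_closedBall_zero_iff, hx, norm_smul, Real.norm_of_nonneg (by positivity),
      inv_mul_le_iff₀ hρ0, mul_one]
    exact hhρ
  have eq1 : (fwdDiff h)^[d + 1] f 0 = q h x := by
    simp only [hq, hx, smul_inv_smul₀ hρ0.ne']
    rw [Function.iterate_succ_apply']
    simp only [fwdDiff, zero_add]
  have eq2 : ρ⁻¹ * P (ballFun (fun z => B z fun _ => h) (hBbd h)) ((1 : ℝ) • h) =
      P (ballFun (fun z => B z fun _ => h) (hBbd h)) x := by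
    rw [one_smul, hx, map_smul, smul_eq_mul]
  have b1 := hl' x hx1
  have b2 := abs_projection_sub_le hPc (F := ballFun (q h) (hqbd h hh))
    (G := restrictBall X (ρ • l)) (by positivity) (fun z => hl' z z.2) hx1
  have b3 := abs_projection_sub_le hPc (F := ballFun (q h) (hqbd h hh))
    (G := ballFun (fun z => B z fun _ => h) (hBbd h)) (by positivity)
    (fun z => hqB h hh z z.2) hx1
  rw [hP] at b2
  beta_reduce
  rw [eq1, eq2]
  have hD1 : 0 ≤ K * (1 + W) * 2 ^ (d + 2) := by positivity
  have hD2 : 2 ^ d * (W * 2 ^ (d + 2)) ≤ 2 ^ d * 2 ^ (d + 2) * (1 + W) := by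
    have : (0 : ℝ) < 2 ^ d * 2 ^ (d + 2) := by positivity
    linarith
  have hD2' := mul_le_mul_of_nonneg_left hD2 (zero_le_one.trans hc')
  have hD1' := le_mul_of_one_le_left hD1 hc'
  have b1' := abs_le.1 b1
  have b2' := abs_le.1 b2
  have b3' := abs_le.1 b3
  refine abs_le.2 ⟨?_, ?_⟩ <;> linarith

/-! ### Comparison of Whitney constants -/

/-- A function with bounded differences of order `d + 2` is approximated on the unit ball by a
polynomial of degree `d + 1`: its almost homogeneous part by `exists_top_approx`, the remainder by the
definition of the Whitney constant of order `d + 1`, and both only near the origin at first. -/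
theorem exists_polynomial_approx_succ (d : ℕ) (hd : 1 ≤ d) :
    ∃ K : ℝ, 0 < K ∧ ∀ (X : Type u) [NormedAddCommGroup X] [NormedSpace ℝ X]
      [FiniteDimensional ℝ X] (W : ℝ) (c : ℝ≥0),
      whitneyConstSpace X (d + 1) < ENNReal.ofReal W → 1 ≤ c →
      IsProjectionBound (StrongDual ℝ X) c →
      ∀ f : X → ℝ, ContinuousOn f (closedBall 0 1) → DiffBound (d + 2) 1 1 f →
      ∃ φ ∈ polynomials X (d + 1), ∀ x ∈ closedBall (0 : X) 1,
        |f x - φ x| ≤ K * c * (1 + W) := by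
  -- With this radius, all the points at which the differences of `f` are evaluated in
  -- `diffBound_sub_diag` and `exists_top_approx` stay in the unit ball.
  set ρ : ℝ := (10 * (((d + 1 : ℕ) : ℝ) + 1) ^ 3)⁻¹ with hρdef
  have hρ : 10 * (((d + 1 : ℕ) : ℝ) + 1) ^ 3 * ρ = 1 := mul_inv_cancel₀ (by positivity)
  have hρ0 : 0 < ρ := by positivity
  have hd0 : (0 : ℝ) ≤ d := Nat.cast_nonneg d
  have hρle : ((d + 1 : ℕ) : ℝ) * ρ ≤ 1 := by
    rw [← hρ]
    refine mul_le_mul_of_nonneg_right ?_ hρ0.le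
    have h1 : (1 : ℝ) ≤ ((d + 1 : ℕ) : ℝ) + 1 := by push_cast; linarith
    have h2 := le_self_pow₀ h1 (show (3 : ℕ) ≠ 0 by norm_num)
    linarith
  have hρ1 : ρ ≤ 1 := by push_cast at hρle; nlinarith
  obtain ⟨K₁, hK₁, htop⟩ := exists_top_approx.{u} d hd hρ
  set K₂ : ℝ := 2 ^ (d + 1) * (((d + 1 : ℕ) : ℝ) ^ (d + 1) * 2 ^ (d + 1 + 1)) with hK₂def
  have hK₂ : 0 < K₂ := by positivity
  -- The number of enlargements of the ball by the factor `m / (m - 1)`, `m = d + 2`, that take it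
  -- from radius `ρ / (d + 1)` to radius `1`.
  obtain ⟨i, hi⟩ := exists_pow_lt_of_lt_one (show 0 < ρ / (d + 1) by positivity)
    (show 1 - (((d + 2 : ℕ) : ℝ))⁻¹ < 1 by
      have : (0 : ℝ) < ((d + 2 : ℕ) : ℝ)⁻¹ := by positivity
      linarith)
  refine ⟨(2 ^ (d + 2) + 1) ^ i * (1 + (K₁ + K₂)), by positivity, ?_⟩
  intro X _ _ _ W c hW hc hproj f hfc hf
  have hWpos : 0 < W := ENNReal.ofReal_pos.1 (bot_lt_of_lt hW)
  have hc' : (1 : ℝ) ≤ c := by exact_mod_cast hc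
  have hcW : 1 ≤ c * (1 + W) := by nlinarith
  obtain ⟨Ψ, hΨ, hΨb⟩ := htop X W c hW hc hproj f hfc hf
  have hlowc : ContinuousOn
      (fun x => f x - ((d + 1).factorial : ℝ)⁻¹ * (fwdDiff x)^[d + 1] f 0) (closedBall 0 ρ) :=
    (hfc.mono (closedBall_subset_closedBall hρ1)).sub
      (continuousOn_const.mul (continuousOn_fwdDiff_iter_diag hfc hρle))
  obtain ⟨p, hp, hpb⟩ := exists_polynomial_approx hW hρ0 hK₂ hlowc
    (diffBound_sub_diag (by omega) hf hρ)
  have hφ : (fun x => p x + ((d + 1).factorial : ℝ)⁻¹ * Ψ ((1 : ℝ) • x)) ∈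
      polynomials X (d + 1) :=
    polynomials_add (polynomials_mono (by omega) hp) (polynomials_smul_comp_smul hΨ _ _)
  simp only [one_smul] at hφ
  refine ⟨_, hφ, fun x hx => ?_⟩
  have hx1 := mem_closedBall_zero_iff.1 hx
  have hfact : ((d + 1).factorial : ℝ)⁻¹ ≤ 1 :=
    inv_le_one_of_one_le₀ (by exact_mod_cast (d + 1).factorial_pos)
  have hsmall : ∀ x : X, ‖x‖ ≤ ρ / (d + 1) → ‖x‖ ≤ 1 →
      |f x - (p x + ((d + 1).factorial : ℝ)⁻¹ * Ψ x)| ≤ (1 + (K₁ + K₂)) * (c * (1 + W)) := by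
    intro x hx _
    have h1 := hpb x (mem_closedBall_zero_iff.2 (hx.trans (div_le_self hρ0.le (by linarith))))
    have h2 := hΨb x hx
    have e : f x - (p x + ((d + 1).factorial : ℝ)⁻¹ * Ψ x) =
        (f x - ((d + 1).factorial : ℝ)⁻¹ * (fwdDiff x)^[d + 1] f 0 - p x) +
          ((d + 1).factorial : ℝ)⁻¹ * ((fwdDiff x)^[d + 1] f 0 - Ψ x) := by ring
    have h3 : |((d + 1).factorial : ℝ)⁻¹ * ((fwdDiff x)^[d + 1] f 0 - Ψ x)| ≤
        K₁ * c * (1 + W) := by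
      rw [abs_mul, abs_of_pos (by positivity)]
      exact (mul_le_of_le_one_left (abs_nonneg _) hfact).trans h2
    have h4 : W * K₂ ≤ K₂ * (c * (1 + W)) := by
      rw [mul_comm]
      refine mul_le_mul_of_nonneg_left ?_ hK₂.le
      nlinarith
    rw [e]
    calc _ ≤ W * K₂ + K₁ * c * (1 + W) := (abs_add_le _ _).trans (add_le_add h1 h3)
      _ ≤ (1 + (K₁ + K₂)) * (c * (1 + W)) := by linarith
  have hdiff : ∀ h : X, ‖((d + 2 : ℕ) : ℝ) • h‖ ≤ 1 → |(fwdDiff h)^[d + 2]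
      (fun x => f x - (p x + ((d + 1).factorial : ℝ)⁻¹ * Ψ x)) 0| ≤ 1 := by
    intro h hh
    have e : (fun x => f x - (p x + ((d + 1).factorial : ℝ)⁻¹ * Ψ x)) =
        f + (-1 : ℝ) • fun x => p x + ((d + 1).factorial : ℝ)⁻¹ * Ψ x := by
      funext y; simp [sub_eq_add_neg]
    rw [e, fwdDiff_iter_add, fwdDiff_iter_const_smul, Pi.add_apply, Pi.smul_apply,
      fwdDiff_iter_polynomial_eq_zero (by omega) hφ, smul_zero, add_zero]
    refine hf 0 h fun j hj => ?_
    have hj' : (j : ℝ) ≤ ((d + 2 : ℕ) : ℝ) := by exact_mod_cast hj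
    rw [norm_smul, Real.norm_natCast] at hh
    rw [zero_add, mem_closedBall_zero_iff, norm_smul, Real.norm_natCast]
    exact (mul_le_mul_of_nonneg_right hj' (norm_nonneg _)).trans hh
  have hD : 1 ≤ (1 + (K₁ + K₂)) * (c * (1 + W)) :=
    one_le_mul_of_one_le_of_one_le (by linarith) hcW
  refine (abs_le_of_abs_le_small (by omega) hdiff hD hsmall i x ?_ hx1).trans
    (by rw [mul_assoc _ (c : ℝ), mul_assoc])
  refine (mul_le_of_le_one_right (pow_nonneg (sub_nonneg.2 (inv_le_one_of_one_le₀ ?_)) _) hx1).trans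
    hi.le
  push_cast
  linarith

theorem one_le_projectionConst (Y : Type u) [NormedAddCommGroup Y] [NormedSpace ℝ Y] :
    1 ≤ projectionConst Y :=
  le_iInf fun c => le_iInf fun hc => le_iInf fun _ => by exact_mod_cast hc

theorem exists_isProjectionBound_le {Y : Type u} [NormedAddCommGroup Y] [NormedSpace ℝ Y]
    (h : projectionConst Y ≠ ∞) :
    ∃ c : ℝ≥0, 1 ≤ c ∧ IsProjectionBound Y c ∧ (c : ℝ≥0∞) ≤ 2 * projectionConst Y := by
  have h0 : projectionConst Y ≠ 0 := (zero_lt_one.trans_le (one_le_projectionConst Y)).ne'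
  have hlt : projectionConst Y < 2 * projectionConst Y := by
    rw [two_mul]
    exact ENNReal.lt_add_right h h0
  conv_lhs at hlt => rw [projectionConst]
  simp only [iInf_lt_iff] at hlt
  obtain ⟨c, hc1, hc, hlt⟩ := hlt
  exact ⟨c, hc1, hc, hlt.le⟩

/-- One step of the induction on the order. The term `1` in the bound for functions is absorbed
by the lower bound for the Whitney constants. -/
theorem exists_whitneyConstSpace_succ_le (n : ℕ) (hn : 2 ≤ n) :
    ∃ K : ℝ≥0, 1 ≤ K ∧ ∀ (X : Type u) [NormedAddCommGroup X] [NormedSpace ℝ X]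
      [FiniteDimensional ℝ X], whitneyConstSpace X (n + 1) ≤
        (K : ℝ≥0∞) * projectionConst (StrongDual ℝ X) * whitneyConstSpace X n := by
  obtain ⟨d, rfl⟩ : ∃ d, n = d + 1 := ⟨n - 1, by omega⟩
  obtain ⟨K, hK, hstep⟩ := exists_polynomial_approx_succ.{u} d (by omega)
  obtain ⟨κ, hκ, hlow⟩ := exists_pos_le_whitneyConstSpace.{u} (d + 1) (by omega)
  refine ⟨max 1 (Real.toNNReal (K * (2 * (κ⁻¹ + 2)))), le_max_left _ _, ?_⟩
  intro X _ _ _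
  rcases subsingleton_or_nontrivial X with hX | hX
  · rw [whitneyConstSpace_of_subsingleton]
    exact zero_le
  have hw0 : whitneyConstSpace X (d + 1) ≠ 0 :=
    ((ENNReal.ofReal_pos.2 hκ).trans_le (hlow X)).ne'
  have hl0 : projectionConst (StrongDual ℝ X) ≠ 0 :=
    (zero_lt_one.trans_le (one_le_projectionConst _)).ne'
  have hKne : ((max 1 (Real.toNNReal (K * (2 * (κ⁻¹ + 2)))) : ℝ≥0) : ℝ≥0∞) ≠ 0 := by
    rw [ENNReal.coe_ne_zero]
    exact (zero_lt_one.trans_le (le_max_left _ _)).ne'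
  by_cases hw : whitneyConstSpace X (d + 1) = ∞
  · rw [hw, ENNReal.mul_top (mul_ne_zero hKne hl0)]
    exact le_top
  by_cases hl : projectionConst (StrongDual ℝ X) = ∞
  · rw [hl, ENNReal.mul_top hKne, ENNReal.top_mul hw0]
    exact le_top
  obtain ⟨c, hc1, hc, hcl⟩ := exists_isProjectionBound_le hl
  set w : ℝ := (whitneyConstSpace X (d + 1)).toReal with hwdef
  have hww : whitneyConstSpace X (d + 1) = ENNReal.ofReal w := (ENNReal.ofReal_toReal hw).symm
  have hκw : κ ≤ w := by
    have := hlow X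
    rw [hww, ENNReal.ofReal_le_ofReal_iff ENNReal.toReal_nonneg] at this
    exact this
  have hw1 : 1 ≤ κ⁻¹ * w := by rwa [le_inv_mul_iff₀ hκ, mul_one]
  have hlt : whitneyConstSpace X (d + 1) < ENNReal.ofReal (2 * w) := by
    rw [hww, ENNReal.ofReal_lt_ofReal_iff (by linarith)]
    linarith
  calc whitneyConstSpace X (d + 1 + 1)
      ≤ ENNReal.ofReal (K * c * (1 + 2 * w)) :=
        whitneyConstSpace_le fun f hf hfd => hstep X _ c hlt hc1 hc f hf hfd
    _ ≤ ENNReal.ofReal (K * (κ⁻¹ + 2) * c * w) := by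
        refine ENNReal.ofReal_le_ofReal ?_
        have h1 : 1 + 2 * w ≤ (κ⁻¹ + 2) * w := by linarith
        have h2 := mul_le_mul_of_nonneg_left h1 (mul_nonneg hK.le c.2)
        have h3 : K * c * ((κ⁻¹ + 2) * w) = K * (κ⁻¹ + 2) * c * w := by ring
        exact h2.trans_eq h3
    _ = ENNReal.ofReal (K * (κ⁻¹ + 2)) * c * whitneyConstSpace X (d + 1) := by
        rw [hww, ENNReal.ofReal_mul (by positivity), ENNReal.ofReal_mul (by positivity),
          ENNReal.ofReal_coe_nnreal]
    _ ≤ ENNReal.ofReal (K * (κ⁻¹ + 2)) * (2 * projectionConst (StrongDual ℝ X)) *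
          whitneyConstSpace X (d + 1) := by gcongr
    _ = ENNReal.ofReal (K * (2 * (κ⁻¹ + 2))) * projectionConst (StrongDual ℝ X) *
          whitneyConstSpace X (d + 1) := by
        rw [show K * (2 * (κ⁻¹ + 2)) = K * (κ⁻¹ + 2) * 2 by ring,
          ENNReal.ofReal_mul (p := K * (κ⁻¹ + 2)) (by positivity), ENNReal.ofReal_ofNat]
        ring
    _ ≤ _ := by
        gcongr
        exact ENNReal.coe_le_coe.2 (le_max_right _ _)

theorem exists_whitneyConstSpace_le (m : ℕ) :
    ∃ C : ℝ≥0, 1 ≤ C ∧ ∀ k : ℕ, 2 ≤ k → k ≤ m →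
      ∀ (X : Type u) [NormedAddCommGroup X] [NormedSpace ℝ X] [FiniteDimensional ℝ X],
        whitneyConstSpace X m ≤ (C : ℝ≥0∞) * projectionConst (StrongDual ℝ X) ^ (m - k) *
          whitneyConstSpace X k := by
  induction m with
  | zero => exact ⟨1, le_rfl, fun k h2 h0 => by omega⟩
  | succ m ih =>
    obtain ⟨C, hC, ih⟩ := ih
    have hself : ∀ (D : ℝ≥0), 1 ≤ D → ∀ (X : Type u) [NormedAddCommGroup X] [NormedSpace ℝ X],
        whitneyConstSpace X (m + 1) ≤ (D : ℝ≥0∞) *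
          projectionConst (StrongDual ℝ X) ^ (m + 1 - (m + 1)) * whitneyConstSpace X (m + 1) := by
      intro D hD X _ _
      rw [Nat.sub_self, pow_zero, mul_one]
      exact le_mul_of_one_le_left' (by exact_mod_cast hD)
    -- For `m ≤ 1` the only admissible `k` is `m + 1`.
    by_cases hm : 2 ≤ m
    · obtain ⟨K, hK, hstep⟩ := exists_whitneyConstSpace_succ_le.{u} m hm
      refine ⟨K * C, one_le_mul_of_one_le_of_one_le hK hC, fun k hk hkm X _ _ _ => ?_⟩
      rcases hkm.eq_or_lt with rfl | hlt
      · exact hself _ (one_le_mul_of_one_le_of_one_le hK hC) X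
      · refine (hstep X).trans ?_
        have h1 := ih k hk (by omega) X
        calc (K : ℝ≥0∞) * projectionConst (StrongDual ℝ X) * whitneyConstSpace X m
            ≤ K * projectionConst (StrongDual ℝ X) * (C * projectionConst (StrongDual ℝ X) ^ (m - k)
              * whitneyConstSpace X k) := by gcongr
          _ = _ := by
            rw [show m + 1 - k = m - k + 1 by omega, pow_succ, ENNReal.coe_mul]
            ring
    · refine ⟨1, le_rfl, fun k hk hkm X _ _ _ => ?_⟩
      obtain rfl : k = m + 1 := by omega
      exact hself 1 le_rfl X

end Whitney

theorem theorem5p2 (m : ℕ) :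
    ∃ C : ℝ≥0, ∀ k : ℕ, 2 ≤ k → k ≤ m →
      ∀ (X : Type*) [NormedAddCommGroup X] [NormedSpace ℝ X] [FiniteDimensional ℝ X],
        Whitney.whitneyConstSpace X m ≤
          (C : ℝ≥0∞) * Whitney.projectionConst (StrongDual ℝ X) ^ (m - k) *
            Whitney.whitneyConstSpace X k := by
  obtain ⟨C, _, hC⟩ := Whitney.exists_whitneyConstSpace_le m
  exact ⟨C, hC⟩
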